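/- Let $P2/m$ be the group $$\left\langle x,y,z,r,m \;\middle|\; [x,y],\,[x,z],\,[y,z],\,r^2,\,m^2,\,(mr)^2,\; x^m=x,\ y^m=y^{-1},\ z^m=z,\ x^r=x^{-1},\ y^r=y,\ z^r=z^{-1}\right\rangle,$$ where $[u,v]=u^{-1}v^{-1}uv$ and $w^g=g^{-1}wg$, and for an integer $n\ge 1$ let $c_n$ be the number of normal subgroups of index $n$ in $P2/m$. Let $\sigma(k)$ be the sum of the positive divisors of $k$. Then $c_n$ is finite for every $n\ge1$, and: 1. $c_1=1$. 2. If $n$ is odd and $n\neq 1$, then $c_n=0$. 3. If $n$ is even, then $c_2=31$, $c_4=155$, $c_8=187$, $c_{16}=199$, and - if $n\equiv 0\pmod{16}$ and $n\ne16$, $$c_n=40+\sigma(n/2)+11\,\sigma(n/4)+12\,\sigma(n/8)+3\sum_{l\mid (n/8)}\sigma(l)+\sum_{l\mid (n/4)}\sigma(l);$$ - if $n\equiv 8\pmod{16}$ and $n\ne8$, $$c_n=36+\sigma(n/2)+11\,\sigma(n/4)+12\,\sigma(n/8)+3\sum_{l\mid (n/8)}\sigma(l)+\sum_{l\mid (n/4)}\sigma(l);$$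 - if $n\equiv 4$ or $12\pmod{16}$ and $n\ne4$, $$c_n=14+\sigma(n/2)+11\,\sigma(n/4)+\sum_{l\mid (n/4)}\sigma(l);$$ - if $n\equiv 2,6,10$ or $14\pmod{16}$ and $n\ne2$, $$c_n=1+\sigma(n/2).$$ -/

import Mathlib

open scoped ArithmeticFunction.sigma

namespace CrystalGroup

/-- The five generators of the space group `P2/m`: three translations `x`, `y`, `z`, a diad
rotation `r` and a reflection `m`. -/
inductive Gen : Type
  | x | y | z | r | m

/-- The word `w ^ g = g⁻¹ w g` in the free group. -/
def conjWord (w g : FreeGroup Gen) : FreeGroup Gen := g⁻¹ * w * g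

/-- The commutator `u⁻¹ v⁻¹ u v` of two words. -/
def commWord (u v : FreeGroup Gen) : FreeGroup Gen := u⁻¹ * v⁻¹ * u * v

/-- The defining relators of `P2/m`; a relation `u = v` is given by the relator `u * v⁻¹`. -/
def relators : Set (FreeGroup Gen) :=
  let x := FreeGroup.of Gen.x
  let y := FreeGroup.of Gen.y
  let z := FreeGroup.of Gen.z
  let r := FreeGroup.of Gen.r
  let m := FreeGroup.of Gen.m
  { commWord x y, commWord x z, commWord y z, r ^ 2, m ^ 2, (m * r) ^ 2,
    conjWord x m * x⁻¹, conjWord y m * (y⁻¹)⁻¹, conjWord z m * z⁻¹,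
    conjWord x r * (x⁻¹)⁻¹, conjWord y r * y⁻¹, conjWord z r * (z⁻¹)⁻¹ }

/-- The space group `P2/m`, given by generators and relations. -/
abbrev P2m : Type := PresentedGroup relators

/-- The normal subgroups of index `n` in a group `G`. It is used for `n ≠ 0` only: `Subgroup.index`
is `0` for subgroups of infinite index. -/
def normalSubgroupsOfIndex (G : Type*) [Group G] (n : ℕ) : Set (Subgroup G) :=
  {H | H.Normal ∧ H.index = n}

/-- The number `c_n` of normal subgroups of index `n` in `P2/m`. -/
noncomputable def c (n : ℕ) : ℕ := (normalSubgroupsOfIndex P2m n).ncard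

/-- The sum of `σ(l)` over all positive divisors `l` of `k`. -/
def sumSigma (k : ℕ) : ℕ := ∑ l ∈ k.divisors, σ 1 l

end CrystalGroup

/-! In `P2/m` the elements `y`, `m` commute with `x`, `z`, `r`, and `m` and `r` invert the
translations of their own block. Hence `P2/m` is the product of `A = Dih ℤ` and `B = Dih ℤ²`
(`dihEquiv`).

By Goursat's lemma (`invHomEquivGoursatFiber`) a normal subgroup `N` of `A × B` amounts to `K = N ∩
A`, the projection `P` of `N` to `B`, and a homomorphism from `P` to the center of `A ⧸ K` that is
constant on `B`-conjugacy classes. The index of `N` is the product of those of `K` and `P`.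

That center has exponent two (`Dih.sq_eq_one_of_mem_center`). If `q` is its order, there are `q ^ d`
such homomorphisms. When `P` is a lattice, `d = 2`. When `P` contains a reflection, it has index `b
= 1, 2, 4` and `d = 3, 2, 1` (`Dih.card_invHom_trans`, `Dih.card_invHom_refl`). There are `σ(b/2)`
lattices of even index `b`, and `1, 6, 4` reflection subgroups of index `1, 2, 4`. On the side of
`A`, `intCount` and `centerCard` give the number of `K` and the value of `q`.

Summing over `a * b = n` gives `c_eq`: the lattices yield the terms with `σ`, the reflection
subgroups the constants. The small exceptional `n` come from the quotients of `A` of order `1`, `2`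
and `4`. -/

namespace CrystalGroup

/-! ### Goursat's lemma for normal subgroups of a product. -/

section Goursat

variable {A B : Type*} [Group A] [Group B]

/-- The homomorphisms from a subgroup `P` of `B` to `Z` that are constant on the conjugacy
classes of `B`. -/
abbrev InvHom (P : Subgroup B) (Z : Type*) [Group Z] : Type _ :=
  {φ : P →* Z // ∀ (b : B) (p q : P), (q : B) = b * p * b⁻¹ → φ q = φ p}

/-- The subgroup of `A × B` formed by the pairs `(a, b)` with `b ∈ P` and `a ∈ φ b`. -/
def goursatSubgroup (K : Subgroup A) [K.Normal] (P : Subgroup B)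
    (φ : P →* Subgroup.center (A ⧸ K)) : Subgroup (A × B) where
  carrier := {g | ∃ h : g.2 ∈ P, (g.1 : A ⧸ K) = φ ⟨g.2, h⟩}
  mul_mem' := by
    rintro ⟨a, b⟩ ⟨a', b'⟩ ⟨h, e⟩ ⟨h', e'⟩
    refine ⟨P.mul_mem h h', ?_⟩
    have : (⟨b * b', P.mul_mem h h'⟩ : P) = ⟨b, h⟩ * ⟨b', h'⟩ := rfl
    simp only [Prod.mk_mul_mk, this, map_mul, Subgroup.coe_mul, ← e, ← e', QuotientGroup.mk_mul]
  one_mem' := ⟨P.one_mem, by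
    have : (⟨(1 : A × B).2, P.one_mem⟩ : P) = 1 := rfl
    rw [this, map_one]; rfl⟩
  inv_mem' := by
    rintro ⟨a, b⟩ ⟨h, e⟩
    refine ⟨P.inv_mem h, ?_⟩
    have : (⟨b⁻¹, P.inv_mem h⟩ : P) = ⟨b, h⟩⁻¹ := rfl
    simp only [Prod.inv_mk, this, map_inv, Subgroup.coe_inv, ← e, QuotientGroup.mk_inv]

/-- The normal subgroups of `A × B` that meet `A` in `K` and project onto `P`. -/
abbrev GoursatFiber (K : Subgroup A) (P : Subgroup B) : Type _ :=
  {N : Subgroup (A × B) // N.Normal ∧ N.comap (MonoidHom.inl A B) = K ∧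
    N.map (MonoidHom.snd A B) = P}

/-- Normality splits into two conditions: conjugation by `B` is absorbed by the invariance of `φ`,
conjugation by `A` by the centrality of its values. -/
theorem goursatSubgroup_mem_fiber (K : Subgroup A) [K.Normal] (P : Subgroup B) [P.Normal]
    (φ : InvHom P (Subgroup.center (A ⧸ K))) :
    (goursatSubgroup K P φ.1).Normal ∧
      (goursatSubgroup K P φ.1).comap (MonoidHom.inl A B) = K ∧
      (goursatSubgroup K P φ.1).map (MonoidHom.snd A B) = P := by
  refine ⟨⟨?_⟩, ?_, ?_⟩
  · rintro ⟨a, b⟩ ⟨h, e⟩ ⟨c, d⟩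
    have hd : d * b * d⁻¹ ∈ P := Subgroup.Normal.conj_mem ‹_› b h d
    refine ⟨hd, ?_⟩
    have h1 : φ.1 ⟨d * b * d⁻¹, hd⟩ = φ.1 ⟨b, h⟩ := φ.2 d ⟨b, h⟩ _ rfl
    have h2 := (Subgroup.mem_center_iff.1 (φ.1 ⟨b, h⟩).2) (c : A ⧸ K)
    change ((c * a * c⁻¹ : A) : A ⧸ K) = ((φ.1 ⟨d * b * d⁻¹, hd⟩ : Subgroup.center _) : A ⧸ K)
    rw [h1, QuotientGroup.mk_mul, QuotientGroup.mk_mul, QuotientGroup.mk_inv]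
    change (a : A ⧸ K) = _ at e
    rw [e, h2, mul_inv_cancel_right]
  · ext a
    constructor
    · rintro ⟨h, e⟩
      have : (⟨((MonoidHom.inl A B) a).2, h⟩ : P) = 1 := rfl
      rw [this, map_one] at e
      exact (QuotientGroup.eq_one_iff a).1 e
    · intro ha
      refine ⟨P.one_mem, ?_⟩
      have : (⟨((MonoidHom.inl A B) a).2, P.one_mem⟩ : P) = 1 := rfl
      rw [this, map_one]
      exact (QuotientGroup.eq_one_iff a).2 ha
  · ext b
    constructor
    · rintro ⟨⟨a, b⟩, ⟨h, -⟩, rfl⟩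
      exact h
    · intro h
      obtain ⟨a, ha⟩ := QuotientGroup.mk_surjective (φ.1 ⟨b, h⟩ : A ⧸ K)
      exact ⟨(a, b), ⟨h, ha⟩, rfl⟩

/-- The elements of `A` paired with a given `p` in `N` form one coset of `K`, and `φ p` is this
coset. Conjugating by `(g, 1)` shows that it is central, by `(1, b)` that `φ` is invariant. -/
theorem exists_goursatSubgroup_eq (K : Subgroup A) [K.Normal] (P : Subgroup B)
    (N : GoursatFiber K P) :
    ∃ φ : InvHom P (Subgroup.center (A ⧸ K)), goursatSubgroup K P φ.1 = N.1 := by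
  obtain ⟨N, hN, hK, hP⟩ := N
  have ex : ∀ p : P, ∃ a : A, (a, (p : B)) ∈ N := by
    rintro ⟨p, hp⟩
    rw [← hP] at hp
    obtain ⟨⟨a, b⟩, h, rfl⟩ := hp
    exact ⟨a, h⟩
  have memK : ∀ a : A, (a, (1 : B)) ∈ N ↔ a ∈ K := by
    intro a
    rw [← hK]
    rfl
  have uniq : ∀ {a a' : A} {b : B}, (a, b) ∈ N → (a', b) ∈ N → (a : A ⧸ K) = a' := by
    intro a a' b h h'
    rw [QuotientGroup.eq, ← memK]
    simpa using N.mul_mem (N.inv_mem h) h'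
  choose f hf using ex
  have cent : ∀ p : P, (f p : A ⧸ K) ∈ Subgroup.center (A ⧸ K) := by
    intro p
    rw [Subgroup.mem_center_iff]
    intro g
    obtain ⟨g, rfl⟩ := QuotientGroup.mk_surjective g
    have := hN.conj_mem _ (hf p) (g, 1)
    have := uniq (by simpa using this) (hf p)
    rw [QuotientGroup.mk_mul, QuotientGroup.mk_mul, QuotientGroup.mk_inv,
      mul_inv_eq_iff_eq_mul] at this
    exact this
  let φ : P →* Subgroup.center (A ⧸ K) := MonoidHom.mk' (fun p => ⟨(f p : A ⧸ K), cent p⟩) (by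
    intro p q
    apply Subtype.ext
    change (f (p * q) : A ⧸ K) = (f p : A ⧸ K) * (f q : A ⧸ K)
    rw [← QuotientGroup.mk_mul]
    exact uniq (hf (p * q)) (N.mul_mem (hf p) (hf q)))
  refine ⟨⟨φ, ?_⟩, ?_⟩
  · intro b p q h
    apply Subtype.ext
    change (f q : A ⧸ K) = (f p : A ⧸ K)
    have := hN.conj_mem _ (hf p) (1, b)
    refine uniq (hf q) ?_
    simpa [h] using this
  · ext ⟨a, b⟩
    constructor
    · rintro ⟨h, e⟩
      change (a : A ⧸ K) = (f ⟨b, h⟩ : A ⧸ K) at e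
      have h1 := (memK _).2 (QuotientGroup.eq.1 e.symm)
      simpa using N.mul_mem (hf ⟨b, h⟩) h1
    · intro h
      have hb : b ∈ P := by
        rw [← hP]
        exact ⟨(a, b), h, rfl⟩
      exact ⟨hb, uniq h (hf ⟨b, hb⟩)⟩

/-- Goursat's lemma for normal subgroups. -/
noncomputable def invHomEquivGoursatFiber (K : Subgroup A) [K.Normal] (P : Subgroup B)
    [P.Normal] : InvHom P (Subgroup.center (A ⧸ K)) ≃ GoursatFiber K P :=
  Equiv.ofBijective (fun φ => ⟨goursatSubgroup K P φ.1, goursatSubgroup_mem_fiber K P φ⟩) (by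
    constructor
    · intro φ ψ h
      have h1 : goursatSubgroup K P φ.1 = goursatSubgroup K P ψ.1 := congrArg Subtype.val h
      refine Subtype.ext (MonoidHom.ext fun p => Subtype.ext ?_)
      obtain ⟨a, ha⟩ := QuotientGroup.mk_surjective (φ.1 p : A ⧸ K)
      have h2 : (a, (p : B)) ∈ goursatSubgroup K P φ.1 := ⟨p.2, ha⟩
      rw [h1] at h2
      obtain ⟨h3, h4⟩ := h2
      exact ha.symm.trans h4
    · intro N
      obtain ⟨φ, hφ⟩ := exists_goursatSubgroup_eq K P N
      exact ⟨φ, Subtype.ext hφ⟩)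

/-- The subgroup `AN` is the preimage of the projection of `N` to `B`, and `[AN : N] = [A : A ∩ N]`.
-/
theorem index_eq_index_mul_index (N : Subgroup (A × B)) [N.Normal] :
    N.index = (N.comap (MonoidHom.inl A B)).index * (N.map (MonoidHom.snd A B)).index := by
  have hsup : (MonoidHom.inl A B).range ⊔ N = (N.map (MonoidHom.snd A B)).comap
      (MonoidHom.snd A B) := by
    rw [Subgroup.comap_map_eq, sup_comm]
    congr 1
    ext ⟨a, b⟩
    constructor
    · rintro ⟨a, h⟩
      exact (congrArg Prod.snd h).symm
    · rintro (rfl : b = 1)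
      exact ⟨a, rfl⟩
  rw [Subgroup.index_comap, ← Subgroup.relIndex_sup_right,
    ← Subgroup.index_comap_of_surjective (N.map (MonoidHom.snd A B)) (f := MonoidHom.snd A B)
      Prod.snd_surjective, ← hsup,
    Subgroup.relIndex_mul_index le_sup_right]

/-- The data to which Goursat's lemma reduces a normal subgroup of `A × B`: a normal subgroup of
index `a` in `A`, one of index `b` in `B`, and an invariant homomorphism. -/
abbrev GoursatData (A B : Type*) [Group A] [Group B] (a b : ℕ) : Type _ :=
  Σ KP : normalSubgroupsOfIndex A a × normalSubgroupsOfIndex B b,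
    GoursatFiber KP.1.1 KP.2.1

/-- The normal subgroups of index `n` in `A × B`, sorted by the indices of the two factors. -/
noncomputable def normalSubgroupsOfIndexProdEquiv (n : ℕ) (hn : n ≠ 0) :
    normalSubgroupsOfIndex (A × B) n ≃
      Σ p : n.divisorsAntidiagonal, GoursatData A B p.1.1 p.1.2 where
  toFun N := by
    have hN := N.2.1
    refine ⟨⟨((N.1.comap (MonoidHom.inl A B)).index, (N.1.map (MonoidHom.snd A B)).index), ?_⟩,
      ⟨⟨⟨N.1.comap (MonoidHom.inl A B), ?_⟩, ⟨N.1.map (MonoidHom.snd A B), ?_⟩⟩,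
        ⟨N.1, N.2.1, rfl, rfl⟩⟩⟩
    · rw [Nat.mem_divisorsAntidiagonal]
      exact ⟨(index_eq_index_mul_index N.1).symm.trans N.2.2, hn⟩
    · exact ⟨inferInstance, rfl⟩
    · exact ⟨hN.map _ Prod.snd_surjective, rfl⟩
  invFun d := ⟨d.2.2.1, by
    obtain ⟨⟨⟨a, b⟩, hp⟩, ⟨⟨⟨K, hK⟩, ⟨P, hP⟩⟩, N, hN, h1, h2⟩⟩ := d
    refine ⟨hN, ?_⟩
    change N.index = n
    change N.comap _ = K at h1
    change N.map _ = P at h2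
    rw [index_eq_index_mul_index, h1, h2, hK.2, hP.2]
    exact (Nat.mem_divisorsAntidiagonal.1 hp).1⟩
  left_inv N := rfl
  right_inv := by
    rintro ⟨⟨⟨a, b⟩, hp⟩, ⟨⟨⟨K, hK⟩, ⟨P, hP⟩⟩, N, hN, h1, h2⟩⟩
    have ha : K.index = a := hK.2
    have hb : P.index = b := hP.2
    change N.comap _ = K at h1
    change N.map _ = P at h2
    -- Once the indices and both subgroups are replaced by their expressions in `N`, the dependent
    -- pairs agree definitionally.
    subst h1 h2 ha hb
    rfl

theorem finite_and_card_normalSubgroupsOfIndex_prod {n : ℕ} (hn : n ≠ 0) (g : ℕ → ℕ → ℕ)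
    (h : ∀ a b, a * b = n → Finite (GoursatData A B a b) ∧
      Nat.card (GoursatData A B a b) = g a b) :
    Finite (normalSubgroupsOfIndex (A × B) n) ∧
      Nat.card (normalSubgroupsOfIndex (A × B) n) = ∑ p ∈ n.divisorsAntidiagonal, g p.1 p.2 := by
  have h' : ∀ p : n.divisorsAntidiagonal, Finite (GoursatData A B p.1.1 p.1.2) ∧
      Nat.card (GoursatData A B p.1.1 p.1.2) = g p.1.1 p.1.2 := fun p =>
    h _ _ (Nat.mem_divisorsAntidiagonal.1 p.2).1
  have inst := fun p => (h' p).1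
  refine ⟨Finite.of_equiv _ (normalSubgroupsOfIndexProdEquiv n hn).symm, ?_⟩
  rw [Nat.card_congr (normalSubgroupsOfIndexProdEquiv n hn), Nat.card_sigma,
    ← Finset.sum_coe_sort n.divisorsAntidiagonal fun p => g p.1 p.2]
  exact Finset.sum_congr rfl fun p _ => (h' p).2

end Goursat

theorem finite_and_card_sigma_of_const {ι : Type*} [Finite ι] {β : ι → Type*} {k : ℕ}
    (hk : k ≠ 0) (h : ∀ i, Nat.card (β i) = k) :
    Finite (Σ i, β i) ∧ Nat.card (Σ i, β i) = Nat.card ι * k := by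
  -- `Nat.card` of an infinite type is `0`, so `hk` is what makes the fibers finite.
  have : ∀ i, Finite (β i) := fun i => Nat.finite_of_card_ne_zero (by rw [h i]; exact hk)
  have := Fintype.ofFinite ι
  refine ⟨inferInstance, ?_⟩
  simp [Nat.card_sigma, h]

/-! ### Sublattices of `ℤ` and `ℤ²`. -/

section Integers

/-- The infinite cyclic group, written multiplicatively. -/
abbrev IntGroup : Type := Multiplicative ℤ

/-- The endomorphism `t ↦ t ^ k` of the infinite cyclic group. -/
abbrev intPow (k : ℕ) : IntGroup →* IntGroup := powMonoidHom k

theorem mem_range_intPow {k : ℕ} {t : IntGroup} :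
    t ∈ (intPow k).range ↔ (k : ℤ) ∣ t.toAdd := by
  constructor
  · rintro ⟨s, rfl⟩
    exact ⟨s.toAdd, by simp⟩
  · rintro ⟨s, hs⟩
    exact ⟨Multiplicative.ofAdd s, Multiplicative.toAdd.injective (by simp [hs])⟩

theorem exists_eq_range_intPow (K : Subgroup IntGroup) : ∃ k, K = (intPow k).range := by
  obtain ⟨a, ha⟩ := Int.subgroup_cyclic (Subgroup.toAddSubgroup' K)
  refine ⟨a.natAbs, ?_⟩
  ext t
  rw [mem_range_intPow, Int.natAbs_dvd]
  have : t ∈ K ↔ t.toAdd ∈ Subgroup.toAddSubgroup' K := Iff.rfl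
  rw [this, ha, AddSubgroup.mem_closure_singleton]
  constructor
  · rintro ⟨n, h⟩
    exact ⟨n, by rw [← h, smul_eq_mul, mul_comm]⟩
  · rintro ⟨n, h⟩
    exact ⟨n, by rw [h, smul_eq_mul, mul_comm]⟩

theorem index_range_intPow (k : ℕ) : (intPow k).range.index = k := by
  have h : (AddSubgroup.zmultiples (k : ℤ)).index = k := by
    rw [Int.index_zmultiples, Int.natAbs_natCast]
  have h2 : (intPow k).range = AddSubgroup.toSubgroup (AddSubgroup.zmultiples (k : ℤ)) := by
    ext t
    rw [mem_range_intPow]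
    exact Int.mem_zmultiples_iff.symm
  rw [h2]
  exact h

theorem eq_range_intPow {K : Subgroup IntGroup} {k : ℕ} (h : K.index = k) :
    K = (intPow k).range := by
  obtain ⟨j, rfl⟩ := exists_eq_range_intPow K
  rw [index_range_intPow] at h
  rw [h]

/-- The infinite cyclic group has a single subgroup of each index. -/
instance uniqueIntSubgroup (k : ℕ) : Unique {K : Subgroup IntGroup // K.index = k} where
  default := ⟨(intPow k).range, index_range_intPow k⟩
  uniq K := Subtype.ext (eq_range_intPow K.2)

theorem intPow_injective {k : ℕ} (hk : k ≠ 0) : Function.Injective (intPow k) := by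
  intro s t h
  have h1 : k • s.toAdd = k • t.toAdd := h
  exact Multiplicative.toAdd.injective (smul_right_injective ℤ hk h1)

/-- A subgroup of nonzero index is itself infinite cyclic, so a homomorphism is a free choice of the
image of a generator. -/
theorem card_hom_intSubgroup {P : Subgroup IntGroup} (hP : P.index ≠ 0) (Z : Type*) [Group Z] :
    Nat.card (P →* Z) = Nat.card Z := by
  have h := eq_range_intPow (K := P) rfl
  rw [h]
  let e := MonoidHom.ofInjective (intPow_injective hP)
  exact Nat.card_congr ((e.monoidHomCongrLeftEquiv (N := Z)).symm.trans (zpowersHom Z).symm)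

theorem card_normalSubgroupsOfIndex_int (k : ℕ) :
    Finite (normalSubgroupsOfIndex IntGroup k) ∧
      Nat.card (normalSubgroupsOfIndex IntGroup k) = 1 := by
  let e : normalSubgroupsOfIndex IntGroup k ≃ {K : Subgroup IntGroup // K.index = k} :=
    Equiv.subtypeEquivRight fun K => ⟨fun h => h.2, fun h => ⟨inferInstance, h⟩⟩
  exact ⟨Finite.of_equiv _ e.symm, by rw [Nat.card_congr e, Nat.card_unique]⟩

/-- There is one choice of `K` and one of `P`; invariance is automatic, so the homomorphisms from
`P` to the group of order `a` are all counted. Summed over `a ∣ n`, this gives `σ(n)` for the plane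
lattice. -/
theorem card_goursatData_int {a b : ℕ} (ha : a ≠ 0) (hb : b ≠ 0) :
    Finite (GoursatData IntGroup IntGroup a b) ∧
      Nat.card (GoursatData IntGroup IntGroup a b) = a := by
  have fa := (card_normalSubgroupsOfIndex_int a).1
  have fb := (card_normalSubgroupsOfIndex_int b).1
  have := finite_and_card_sigma_of_const
    (ι := normalSubgroupsOfIndex IntGroup a × normalSubgroupsOfIndex IntGroup b)
    (β := fun KP => GoursatFiber KP.1.1 KP.2.1) (k := a) ha (by
      rintro ⟨⟨K, hK, rfl⟩, ⟨P, hP, rfl⟩⟩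
      change Nat.card (GoursatFiber K P) = K.index
      rw [← Nat.card_congr (invHomEquivGoursatFiber K P)]
      have e : InvHom P (Subgroup.center (IntGroup ⧸ K)) ≃
          (P →* Subgroup.center (IntGroup ⧸ K)) :=
        Equiv.subtypeUnivEquiv fun φ b p q h => by
          congr 1
          apply Subtype.ext
          rw [h, mul_comm b, mul_inv_cancel_right]
      rw [Nat.card_congr e, card_hom_intSubgroup hb, CommGroup.center_eq_top,
        Subgroup.card_top, Subgroup.index])
  rw [Nat.card_prod, (card_normalSubgroupsOfIndex_int a).2,
    (card_normalSubgroupsOfIndex_int b).2, one_mul, one_mul] at this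
  exact this

/-- The free abelian group of rank two, written multiplicatively. -/
abbrev PlaneGroup : Type := IntGroup × IntGroup

/-- The plane lattice has `σ(n)` sublattices of index `n`. -/
theorem card_planeSubgroup {n : ℕ} (hn : n ≠ 0) :
    Finite {M : Subgroup PlaneGroup // M.index = n} ∧
      Nat.card {M : Subgroup PlaneGroup // M.index = n} = σ 1 n := by
  have h := finite_and_card_normalSubgroupsOfIndex_prod (A := IntGroup) (B := IntGroup) hn
    (fun a _ => a) fun a b hab => card_goursatData_int (by rintro rfl; simp at hab; omega)
      (by rintro rfl; simp at hab; omega)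
  let e : normalSubgroupsOfIndex PlaneGroup n ≃ {K : Subgroup PlaneGroup // K.index = n} :=
    Equiv.subtypeEquivRight fun K => ⟨fun h => h.2, fun h => ⟨inferInstance, h⟩⟩
  have := h.1
  refine ⟨Finite.of_equiv _ e, ?_⟩
  rw [← Nat.card_congr e, h.2, ArithmeticFunction.sigma_one_apply]
  exact Nat.sum_divisorsAntidiagonal fun a _ => a

end Integers

/-! ### Generalized dihedral groups and their normal subgroups. -/

/-- The generalized dihedral group of a commutative group `L`: the semidirect product of `L` with
a group of order two that acts on it by inversion. -/
@[ext]
structure Dih (L : Type*) where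
  /-- the translation part -/
  pos : L
  /-- the linear part -/
  sign : ℤˣ

namespace Dih

variable {L : Type*} [CommGroup L]

instance : Mul (Dih L) := ⟨fun g h => ⟨g.pos * h.pos ^ (g.sign : ℤ), g.sign * h.sign⟩⟩
instance : One (Dih L) := ⟨⟨1, 1⟩⟩
instance : Inv (Dih L) := ⟨fun g => ⟨g.pos⁻¹ ^ (g.sign : ℤ), g.sign⟩⟩

theorem mk_mul_mk (v w : L) (e d : ℤˣ) :
    (⟨v, e⟩ * ⟨w, d⟩ : Dih L) = ⟨v * w ^ (e : ℤ), e * d⟩ := rfl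
theorem inv_mk (v : L) (e : ℤˣ) : (⟨v, e⟩⁻¹ : Dih L) = ⟨v⁻¹ ^ (e : ℤ), e⟩ := rfl
theorem one_eq : (1 : Dih L) = ⟨1, 1⟩ := rfl

instance : Group (Dih L) := Group.ofLeftAxioms
  (by
    rintro ⟨u, e⟩ ⟨v, d⟩ ⟨w, c⟩
    simp only [mk_mul_mk, mul_assoc, mul_zpow, Units.val_mul, zpow_mul' w])
  (by
    rintro ⟨u, e⟩
    simp [mk_mul_mk, one_eq])
  (by
    rintro ⟨u, e⟩
    simp only [mk_mul_mk, inv_mk, one_eq, inv_zpow, inv_mul_cancel, Int.units_mul_self])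

/-- The inclusion of the translations. -/
def rot : L →* Dih L where
  toFun v := ⟨v, 1⟩
  map_one' := rfl
  map_mul' v w := by simp [mk_mul_mk]

/-- The linear part as a homomorphism. -/
def signHom : Dih L →* ℤˣ where
  toFun := sign
  map_one' := rfl
  map_mul' _ _ := rfl

/-- The reflection `w ↦ v * w⁻¹`. -/
def refl (v : L) : Dih L := ⟨v, -1⟩

theorem eq_rot_or_eq_refl (g : Dih L) : (∃ v, g = rot v) ∨ ∃ v, g = refl v := by
  obtain ⟨v, e⟩ := g
  obtain rfl | rfl := Int.units_eq_one_or e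
  · exact Or.inl ⟨v, rfl⟩
  · exact Or.inr ⟨v, rfl⟩

theorem rot_injective : Function.Injective (rot : L → Dih L) := fun _ _ h => congrArg pos h

theorem rot_mul_refl (v w : L) : rot v * refl w = refl (v * w) := by
  simp [rot, refl, mk_mul_mk]

theorem refl_mul_rot (v w : L) : refl v * rot w = refl (v * w⁻¹) := by
  simp [rot, refl, mk_mul_mk]

theorem refl_mul_refl (v w : L) : refl v * refl w = rot (v * w⁻¹) := by
  simp [rot, refl, mk_mul_mk]

theorem inv_refl (v : L) : (refl v)⁻¹ = refl v := by
  simp [refl, inv_mk]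

theorem inv_rot (v : L) : (rot v)⁻¹ = rot v⁻¹ := (map_inv rot v).symm

theorem ker_signHom : (signHom : Dih L →* ℤˣ).ker = rot.range := by
  ext g
  constructor
  · intro h
    exact ⟨g.pos, Dih.ext rfl (show (1 : ℤˣ) = g.sign from h.symm)⟩
  · rintro ⟨v, rfl⟩
    rfl

theorem refl_notMem_range_rot (v : L) : refl v ∉ (rot : L →* Dih L).range := by
  rintro ⟨w, h⟩
  exact absurd (congrArg sign h) (by decide : (1 : ℤˣ) ≠ -1)

theorem index_range_rot : (rot : L →* Dih L).range.index = 2 := by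
  rw [← ker_signHom, Subgroup.index_ker]
  have : (signHom : Dih L →* ℤˣ).range = ⊤ :=
    MonoidHom.range_eq_top.2 fun e => ⟨⟨1, e⟩, rfl⟩
  rw [this, Subgroup.card_top, Nat.card_eq_fintype_card]
  rfl

theorem index_map_rot (M : Subgroup L) : (M.map rot).index = 2 * M.index := by
  rw [Subgroup.index_map_of_injective M rot_injective, index_range_rot, mul_comm]

theorem rot_mem_map_rot {M : Subgroup L} {v : L} : rot v ∈ M.map rot ↔ v ∈ M :=
  Subgroup.mem_map_iff_mem rot_injective

/-- Conjugation by a reflection inverts translations, and every subgroup is closed under inverses.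
-/
instance normal_map_rot (M : Subgroup L) : (M.map rot).Normal := by
  constructor
  rintro _ ⟨v, hv, rfl⟩ g
  obtain ⟨w, rfl⟩ | ⟨w, rfl⟩ := eq_rot_or_eq_refl g
  · rw [inv_rot, ← map_mul, ← map_mul, mul_comm w, mul_inv_cancel_right]
    exact ⟨v, hv, rfl⟩
  · rw [inv_refl, refl_mul_rot, refl_mul_refl]
    refine ⟨v⁻¹, M.inv_mem hv, ?_⟩
    congr 1
    rw [mul_comm w, mul_inv_cancel_right]

/-- The normal subgroups of the dihedral group that consist of translations. -/
abbrev TransSubgroup (L : Type*) [CommGroup L] (b : ℕ) : Type _ :=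
  {P : normalSubgroupsOfIndex (Dih L) b // P.1 ≤ rot.range}

/-- The normal subgroups of the dihedral group that contain a reflection. -/
abbrev ReflSubgroup (L : Type*) [CommGroup L] (b : ℕ) : Type _ :=
  {P : normalSubgroupsOfIndex (Dih L) b // ¬ P.1 ≤ rot.range}

/-- A subgroup that consists of translations is a subgroup of `L`. -/
def transSubgroupEquiv (b : ℕ) :
    TransSubgroup L b ≃ {M : Subgroup L // 2 * M.index = b} where
  toFun P := ⟨P.1.1.comap rot, by
    rw [← index_map_rot, Subgroup.map_comap_eq_self P.2, P.1.2.2]⟩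
  invFun M := ⟨⟨M.1.map rot, inferInstance, by rw [index_map_rot, M.2]⟩,
    Subgroup.map_le_range _ _⟩
  left_inv P := Subtype.ext (Subtype.ext (Subgroup.map_comap_eq_self P.2))
  right_inv M := Subtype.ext (Subgroup.comap_map_eq_self_of_injective rot_injective _)

/-- The subgroup of squares. -/
abbrev squares (L : Type*) [CommGroup L] : Subgroup L := (powMonoidHom 2 : L →* L).range

theorem sq_mem_squares (v : L) : v ^ 2 ∈ squares L := ⟨v, rfl⟩

theorem mul_self_eq_one_of_squares_le {M : Subgroup L} (hM : squares L ≤ M) (q : L ⧸ M) :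
    q * q = 1 := by
  obtain ⟨v, rfl⟩ := QuotientGroup.mk_surjective q
  rw [← QuotientGroup.mk_mul, QuotientGroup.eq_one_iff, ← pow_two]
  exact hM (sq_mem_squares v)

theorem inv_eq_self_of_squares_le {M : Subgroup L} (hM : squares L ≤ M) (q : L ⧸ M) :
    q⁻¹ = q := inv_eq_of_mul_eq_one_left (mul_self_eq_one_of_squares_le hM q)

/-- The homomorphism from the dihedral group to `L ⧸ M` that is the projection on the translations
and sends the reflection in the origin to `q`. -/
def reflHom (M : Subgroup L) (hM : squares L ≤ M) (q : L ⧸ M) : Dih L →* L ⧸ M :=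
  MonoidHom.mk' (fun g => (g.pos : L ⧸ M) * if g.sign = 1 then 1 else q) (by
    have hq := mul_self_eq_one_of_squares_le hM q
    rintro ⟨v, e⟩ ⟨w, d⟩
    have hw := inv_eq_self_of_squares_le hM (w : L ⧸ M)
    have h1 : (-1 : ℤˣ) ≠ 1 := by decide
    obtain rfl | rfl := Int.units_eq_one_or e <;> obtain rfl | rfl := Int.units_eq_one_or d <;>
      simp [mk_mul_mk, h1, hw, mul_assoc, mul_left_comm q, hq, mul_comm q])

theorem reflHom_rot (M : Subgroup L) (hM : squares L ≤ M) (q : L ⧸ M) (v : L) :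
    reflHom M hM q (rot v) = v := by
  simp [reflHom, rot]

theorem reflHom_refl (M : Subgroup L) (hM : squares L ≤ M) (q : L ⧸ M) (v : L) :
    reflHom M hM q (refl v) = v * q := by
  have h1 : (-1 : ℤˣ) ≠ 1 := by decide
  simp [reflHom, refl, h1]

theorem comap_rot_ker_reflHom (M : Subgroup L) (hM : squares L ≤ M) (q : L ⧸ M) :
    (reflHom M hM q).ker.comap rot = M := by
  ext v
  rw [Subgroup.mem_comap, MonoidHom.mem_ker, reflHom_rot, QuotientGroup.eq_one_iff]

theorem refl_mem_ker_reflHom {M : Subgroup L} {hM : squares L ≤ M} {q : L ⧸ M} {v : L} :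
    refl v ∈ (reflHom M hM q).ker ↔ (v : L ⧸ M) = q := by
  rw [MonoidHom.mem_ker, reflHom_refl, mul_eq_one_iff_eq_inv, inv_eq_self_of_squares_le hM]

theorem index_ker_reflHom (M : Subgroup L) (hM : squares L ≤ M) (q : L ⧸ M) :
    (reflHom M hM q).ker.index = M.index := by
  have : (reflHom M hM q).range = ⊤ := MonoidHom.range_eq_top.2 fun p => by
    obtain ⟨v, rfl⟩ := QuotientGroup.mk_surjective p
    exact ⟨rot v, reflHom_rot M hM q v⟩
  rw [Subgroup.index_ker, this, Subgroup.card_top, Subgroup.index]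

theorem exists_refl_mem {P : Subgroup (Dih L)} (h : ¬ P ≤ rot.range) : ∃ v, refl v ∈ P := by
  obtain ⟨g, hg, h'⟩ := SetLike.not_le_iff_exists.1 h
  obtain ⟨v, rfl⟩ | ⟨v, rfl⟩ := eq_rot_or_eq_refl g
  · exact absurd ⟨v, rfl⟩ h'
  · exact ⟨v, hg⟩

/-- Conjugating `refl v` by `rot w` gives `refl (w ^ 2 * v)`; its product with `refl v` is `rot (w ^
2)`. -/
theorem squares_le_comap_rot {P : Subgroup (Dih L)} [hP : P.Normal] (h : ¬ P ≤ rot.range) :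
    squares L ≤ P.comap rot := by
  obtain ⟨v, hv⟩ := exists_refl_mem h
  rintro _ ⟨w, rfl⟩
  have := P.mul_mem (hP.conj_mem _ hv (rot w)) hv
  rw [inv_rot, rot_mul_refl, refl_mul_rot, refl_mul_refl] at this
  convert this using 2
  simp [pow_two, mul_comm, mul_left_comm]

/-- The points `v` with `refl v ∈ P` form a single coset of the lattice of `P`; this coset is `q`.
-/
theorem exists_ker_reflHom_eq (P : Subgroup (Dih L)) [hP : P.Normal] (h : ¬ P ≤ rot.range) :
    ∃ q, (reflHom (P.comap rot) (squares_le_comap_rot h) q).ker = P := by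
  obtain ⟨v, hv⟩ := exists_refl_mem h
  refine ⟨v, ?_⟩
  ext g
  obtain ⟨w, rfl⟩ | ⟨w, rfl⟩ := eq_rot_or_eq_refl g
  · rw [← Subgroup.mem_comap, comap_rot_ker_reflHom, Subgroup.mem_comap]
  · rw [refl_mem_ker_reflHom, eq_comm, QuotientGroup.eq, mul_comm, Subgroup.mem_comap,
      ← refl_mul_refl]
    exact Subgroup.mul_mem_cancel_right P hv

/-- A normal subgroup that contains a reflection is given by its lattice, which contains the
squares, and by a coset of this lattice. -/
noncomputable def reflSubgroupEquiv (b : ℕ) :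
    (Σ M : {M : Subgroup L // squares L ≤ M ∧ M.index = b}, L ⧸ M.1) ≃ ReflSubgroup L b :=
  Equiv.ofBijective (fun d => ⟨⟨(reflHom d.1.1 d.1.2.1 d.2).ker, inferInstance, by
      rw [index_ker_reflHom, d.1.2.2]⟩, fun h => by
        obtain ⟨v, hv⟩ := QuotientGroup.mk_surjective d.2
        exact refl_notMem_range_rot v (h (refl_mem_ker_reflHom.2 hv))⟩) (by
    constructor
    · rintro ⟨⟨M, hM⟩, q⟩ ⟨⟨M', hM'⟩, q'⟩ h
      have h1 : (reflHom M hM.1 q).ker = (reflHom M' hM'.1 q').ker :=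
        congrArg (fun P => P.1.1) h
      have h2 : M = M' := by
        rw [← comap_rot_ker_reflHom M hM.1 q, h1, comap_rot_ker_reflHom]
      subst h2
      obtain ⟨v, rfl⟩ := QuotientGroup.mk_surjective q
      have h3 : refl v ∈ (reflHom M hM.1 v).ker := refl_mem_ker_reflHom.2 rfl
      rw [h1, refl_mem_ker_reflHom] at h3
      rw [← h3]
    · rintro ⟨⟨P, hP, hb⟩, h⟩
      obtain ⟨q, hq⟩ := exists_ker_reflHom_eq P h
      refine ⟨⟨⟨P.comap rot, squares_le_comap_rot h, ?_⟩, q⟩, ?_⟩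
      · rw [← index_ker_reflHom _ (squares_le_comap_rot h) q, hq, hb]
      · exact Subtype.ext (Subtype.ext hq))

theorem card_reflSubgroup {b : ℕ} (hb : b ≠ 0)
    [Finite {M : Subgroup L // squares L ≤ M ∧ M.index = b}] :
    Finite (ReflSubgroup L b) ∧ Nat.card (ReflSubgroup L b) =
      Nat.card {M : Subgroup L // squares L ≤ M ∧ M.index = b} * b := by
  have h := finite_and_card_sigma_of_const
    (ι := {M : Subgroup L // squares L ≤ M ∧ M.index = b}) (β := fun M => L ⧸ M.1) hb
    fun M => M.2.2
  have := h.1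
  exact ⟨Finite.of_equiv _ (reflSubgroupEquiv b), by
    rw [← Nat.card_congr (reflSubgroupEquiv b), h.2]⟩

end Dih

/-! ### Counting the normal subgroups of the two dihedral groups. -/

theorem index_squares_int : (Dih.squares IntGroup).index = 2 := index_range_intPow 2

theorem index_squares_plane : (Dih.squares PlaneGroup).index = 4 := by
  have : Dih.squares PlaneGroup = (Dih.squares IntGroup).prod (Dih.squares IntGroup) := by
    ext ⟨s, t⟩
    constructor
    · rintro ⟨⟨s', t'⟩, h⟩
      exact ⟨⟨s', congrArg Prod.fst h⟩, ⟨t', congrArg Prod.snd h⟩⟩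
    · rintro ⟨⟨s', hs⟩, ⟨t', ht⟩⟩
      exact ⟨⟨s', t'⟩, Prod.ext hs ht⟩
  rw [this, Subgroup.index_prod, index_squares_int]

section Sublattices

variable {L : Type*} [CommGroup L]

theorem card_squares_le_index_one :
    Finite {M : Subgroup L // Dih.squares L ≤ M ∧ M.index = 1} ∧
      Nat.card {M : Subgroup L // Dih.squares L ≤ M ∧ M.index = 1} = 1 := by
  have : Unique {M : Subgroup L // Dih.squares L ≤ M ∧ M.index = 1} :=
    { default := ⟨⊤, le_top, Subgroup.index_top⟩
      uniq := fun M => Subtype.ext (Subgroup.index_eq_one.1 M.2.2) }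
  exact ⟨inferInstance, Nat.card_unique⟩

theorem card_squares_le_index_squares {b : ℕ} (hb : b ≠ 0) (h : (Dih.squares L).index = b) :
    Finite {M : Subgroup L // Dih.squares L ≤ M ∧ M.index = b} ∧
      Nat.card {M : Subgroup L // Dih.squares L ≤ M ∧ M.index = b} = 1 := by
  have : Unique {M : Subgroup L // Dih.squares L ≤ M ∧ M.index = b} :=
    { default := ⟨Dih.squares L, le_rfl, h⟩
      uniq := by
        rintro ⟨M, hM, hM'⟩
        refine Subtype.ext (le_antisymm ?_ hM)
        have := Subgroup.relIndex_mul_index hM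
        rw [h, hM'] at this
        exact Subgroup.relIndex_eq_one.1 (Nat.eq_of_mul_eq_mul_right (Nat.pos_of_ne_zero hb)
          (this.trans (one_mul b).symm)) }
  exact ⟨inferInstance, Nat.card_unique⟩

theorem card_squares_le_of_not_dvd {b : ℕ} (h : ¬ b ∣ (Dih.squares L).index) :
    Finite {M : Subgroup L // Dih.squares L ≤ M ∧ M.index = b} ∧
      Nat.card {M : Subgroup L // Dih.squares L ≤ M ∧ M.index = b} = 0 := by
  have : IsEmpty {M : Subgroup L // Dih.squares L ≤ M ∧ M.index = b} :=
    ⟨fun M => h (by rw [← M.2.2]; exact Subgroup.index_dvd_of_le M.2.1)⟩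
  exact ⟨inferInstance, Nat.card_of_isEmpty⟩

end Sublattices

/-- A subgroup of index two contains all squares, so the count is `σ(2) = 3`. -/
theorem card_plane_squares_le_index_two :
    Finite {M : Subgroup PlaneGroup // Dih.squares PlaneGroup ≤ M ∧ M.index = 2} ∧
      Nat.card {M : Subgroup PlaneGroup // Dih.squares PlaneGroup ≤ M ∧ M.index = 2} = 3 := by
  let e : {M : Subgroup PlaneGroup // Dih.squares PlaneGroup ≤ M ∧ M.index = 2} ≃
      {M : Subgroup PlaneGroup // M.index = 2} :=
    Equiv.subtypeEquivRight fun M => ⟨fun h => h.2, fun h => ⟨by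
      rintro _ ⟨v, rfl⟩
      exact Subgroup.sq_mem_of_index_two h v, h⟩⟩
  obtain ⟨h1, h2⟩ := card_planeSubgroup (n := 2) two_ne_zero
  refine ⟨Finite.of_equiv _ e.symm, ?_⟩
  rw [Nat.card_congr e, h2]
  decide +kernel

/-- The number of normal subgroups of index `b` in the dihedral group of the plane lattice that
contain a reflection. -/
def planeReflCount (b : ℕ) : ℕ := if b = 1 then 1 else if b = 2 then 6 else if b = 4 then 4 else 0

theorem card_reflSubgroup_plane {b : ℕ} (hb : b ≠ 0) :
    Finite (Dih.ReflSubgroup PlaneGroup b) ∧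
      Nat.card (Dih.ReflSubgroup PlaneGroup b) = planeReflCount b := by
  have key : ∀ k, Finite {M : Subgroup PlaneGroup // Dih.squares PlaneGroup ≤ M ∧ M.index = b} ∧
      Nat.card {M : Subgroup PlaneGroup // Dih.squares PlaneGroup ≤ M ∧ M.index = b} = k →
      Finite (Dih.ReflSubgroup PlaneGroup b) ∧
        Nat.card (Dih.ReflSubgroup PlaneGroup b) = k * b := by
    rintro k ⟨h1, rfl⟩
    exact Dih.card_reflSubgroup hb
  rw [planeReflCount]
  split_ifs with h1 h2 h4
  · subst h1; exact key _ card_squares_le_index_one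
  · subst h2; exact key _ card_plane_squares_le_index_two
  · subst h4; exact key _ (card_squares_le_index_squares hb index_squares_plane)
  · convert key 0 (card_squares_le_of_not_dvd ?_) using 2
    · rw [zero_mul]
    · rw [index_squares_plane]
      intro h
      have := Nat.le_of_dvd (by norm_num) h
      interval_cases b <;> omega

/-- The number of normal subgroups of index `a` in the infinite dihedral group that contain a
reflection. -/
def intReflCount (a : ℕ) : ℕ := if a = 1 then 1 else if a = 2 then 2 else 0

theorem card_reflSubgroup_int {a : ℕ} (ha : a ≠ 0) :
    Finite (Dih.ReflSubgroup IntGroup a) ∧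
      Nat.card (Dih.ReflSubgroup IntGroup a) = intReflCount a := by
  have key : ∀ k, Finite {M : Subgroup IntGroup // Dih.squares IntGroup ≤ M ∧ M.index = a} ∧
      Nat.card {M : Subgroup IntGroup // Dih.squares IntGroup ≤ M ∧ M.index = a} = k →
      Finite (Dih.ReflSubgroup IntGroup a) ∧
        Nat.card (Dih.ReflSubgroup IntGroup a) = k * a := by
    rintro k ⟨h1, rfl⟩
    exact Dih.card_reflSubgroup ha
  rw [intReflCount]
  split_ifs with h1 h2
  · subst h1; exact key _ card_squares_le_index_one
  · subst h2; exact key _ (card_squares_le_index_squares ha index_squares_int)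
  · convert key 0 (card_squares_le_of_not_dvd ?_) using 2
    · rw [zero_mul]
    · rw [index_squares_int]
      intro h
      have := Nat.le_of_dvd (by norm_num) h
      interval_cases a <;> omega

theorem card_transSubgroup {L : Type*} [CommGroup L] {k : ℕ → ℕ}
    (h : ∀ n ≠ 0, Finite {M : Subgroup L // M.index = n} ∧
      Nat.card {M : Subgroup L // M.index = n} = k n) {b : ℕ} (hb : b ≠ 0) :
    Finite (Dih.TransSubgroup L b) ∧
      Nat.card (Dih.TransSubgroup L b) = if 2 ∣ b then k (b / 2) else 0 := by
  have e := Dih.transSubgroupEquiv (L := L) b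
  split_ifs with h2
  · let e' : {M : Subgroup L // 2 * M.index = b} ≃ {M : Subgroup L // M.index = b / 2} :=
      Equiv.subtypeEquivRight fun M => by omega
    obtain ⟨h1, h3⟩ := h (b / 2) (by omega)
    exact ⟨Finite.of_equiv _ (e.trans e').symm, by rw [Nat.card_congr (e.trans e'), h3]⟩
  · have : IsEmpty {M : Subgroup L // 2 * M.index = b} := ⟨fun M => h2 ⟨_, M.2.symm⟩⟩
    exact ⟨Finite.of_equiv _ e.symm, by rw [Nat.card_congr e, Nat.card_of_isEmpty]⟩

/-- The number of normal subgroups of index `a` in the infinite dihedral group. -/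
def intCount (a : ℕ) : ℕ := if a = 1 then 1 else if a = 2 then 3 else if 2 ∣ a then 1 else 0

open scoped Classical in
theorem card_normalSubgroupsOfIndex_dih_int {a : ℕ} (ha : a ≠ 0) :
    Finite (normalSubgroupsOfIndex (Dih IntGroup) a) ∧
      Nat.card (normalSubgroupsOfIndex (Dih IntGroup) a) = intCount a := by
  have e := Equiv.sumCompl
    fun P : normalSubgroupsOfIndex (Dih IntGroup) a => P.1 ≤ Dih.rot.range
  obtain ⟨h1, h2⟩ := card_transSubgroup (L := IntGroup) (k := fun _ => 1)
    (fun n _ => ⟨inferInstance, Nat.card_unique⟩) ha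
  obtain ⟨h3, h4⟩ := card_reflSubgroup_int ha
  refine ⟨Finite.of_equiv _ e, ?_⟩
  rw [← Nat.card_congr e, Nat.card_sum, h2, h4, intReflCount, intCount]
  by_cases h5 : a = 1
  · simp [h5]
  · by_cases h6 : a = 2
    · simp [h6]
    · simp [h5, h6]

/-! ### Homomorphisms to groups of exponent two -/

/-- Both groups are vector spaces over `ZMod 2`, and a linear map is determined by arbitrary values
on a basis of `d` elements. -/
theorem card_hom_of_exponent_two {V Z : Type*} [CommGroup V] [CommGroup Z] [Finite V]
    (hV : ∀ v : V, v ^ 2 = 1) (hZ : ∀ z : Z, z ^ 2 = 1) {d : ℕ} (hd : Nat.card V = 2 ^ d) :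
    Nat.card (V →* Z) = Nat.card Z ^ d := by
  let _ : Module (ZMod 2) (Additive V) := AddCommGroup.zmodModule hV
  let _ : Module (ZMod 2) (Additive Z) := AddCommGroup.zmodModule hZ
  have hfin : Module.finrank (ZMod 2) (Additive V) = d := by
    have h := Module.natCard_eq_pow_finrank (K := ZMod 2) (V := Additive V)
    rw [Nat.card_zmod] at h
    exact Nat.pow_right_injective le_rfl (h.symm.trans hd)
  let e : (V →* Z) ≃ (Fin d → Additive Z) :=
    (MonoidHom.toAdditive.trans (AddMonoidHom.toZModLinearMapEquiv 2).toEquiv).trans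
      ((Module.finBasisOfFinrankEq (ZMod 2) (Additive V) hfin).constr ℕ).symm.toEquiv
  rw [Nat.card_congr e, Nat.card_fun, Nat.card_fin]
  rfl

/-- These are the homomorphisms from `P ⧸ D`, which has exponent two and is therefore commutative.
-/
theorem card_hom_le_ker {P Z : Type*} [Group P] [CommGroup Z] (D : Subgroup P) [D.Normal]
    (hD : ∀ p, p ^ 2 ∈ D) (hZ : ∀ z : Z, z ^ 2 = 1) {d : ℕ} (hd : D.index = 2 ^ d) :
    Nat.card {φ : P →* Z // D ≤ φ.ker} = Nat.card Z ^ d := by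
  have hV : ∀ v : P ⧸ D, v ^ 2 = 1 := fun v => by
    obtain ⟨p, rfl⟩ := QuotientGroup.mk_surjective v
    exact (QuotientGroup.eq_one_iff _).2 (hD p)
  let _ : CommGroup (P ⧸ D) := { (inferInstance : Group (P ⧸ D)) with
    mul_comm := fun x y => by
      have h : ∀ v : P ⧸ D, v⁻¹ = v := fun v =>
        inv_eq_of_mul_eq_one_left (by rw [← pow_two, hV])
      rw [← h (x * y), mul_inv_rev, h, h] }
  have : Finite (P ⧸ D) := Nat.finite_of_card_ne_zero
    (show D.index ≠ 0 by rw [hd]; positivity)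
  rw [← card_hom_of_exponent_two hV hZ hd]
  exact Nat.card_congr
    { toFun := fun φ => QuotientGroup.lift D φ.1 φ.2
      invFun := fun ψ => ⟨ψ.comp (QuotientGroup.mk' D), fun p hp => by
        rw [MonoidHom.mem_ker, MonoidHom.comp_apply, QuotientGroup.mk'_apply,
          (QuotientGroup.eq_one_iff p).2 hp, map_one]⟩
      left_inv := fun φ => rfl
      right_inv := fun ψ => by
        ext p
        rfl }

/-! ### Centers of the quotients. -/

namespace Dih

variable {L : Type*} [CommGroup L]

/-- Translations commute with each other, and the commutator of `rot v` with any reflection is a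
translation by `v ^ 2` or its inverse. -/
theorem mk_rot_mem_center {M : Subgroup L} {v : L} :
    (rot v : Dih L ⧸ M.map rot) ∈ Subgroup.center (Dih L ⧸ M.map rot) ↔ v ^ 2 ∈ M := by
  rw [Subgroup.mem_center_iff]
  have key : ∀ w : L, (((refl w * rot v : Dih L) : Dih L ⧸ M.map rot) =
      ((rot v * refl w : Dih L) : Dih L ⧸ M.map rot)) ↔ v ^ 2 ∈ M := by
    intro w
    rw [QuotientGroup.eq, refl_mul_rot, rot_mul_refl, inv_refl, refl_mul_refl, rot_mem_map_rot,
      ← M.inv_mem_iff]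
    congr! 1
    simp [pow_two, mul_comm, mul_left_comm]
  constructor
  · intro h
    exact (key 1).1 (h (refl 1 : Dih L))
  · intro h g
    obtain ⟨g, rfl⟩ := QuotientGroup.mk_surjective g
    obtain ⟨w, rfl⟩ | ⟨w, rfl⟩ := eq_rot_or_eq_refl g
    · rw [← QuotientGroup.mk_mul, ← QuotientGroup.mk_mul, ← map_mul, ← map_mul, mul_comm]
    · exact (key w).2 h

theorem squares_le_of_mk_refl_mem_center {M : Subgroup L} {v : L}
    (h : (refl v : Dih L ⧸ M.map rot) ∈ Subgroup.center (Dih L ⧸ M.map rot)) :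
    squares L ≤ M := by
  rintro _ ⟨w, rfl⟩
  have := Subgroup.mem_center_iff.1 h (rot w : Dih L)
  rw [← QuotientGroup.mk_mul, ← QuotientGroup.mk_mul, QuotientGroup.eq, refl_mul_rot,
    rot_mul_refl, inv_refl, refl_mul_refl, rot_mem_map_rot] at this
  convert this using 1
  simp [pow_two, mul_comm, mul_left_comm]

/-- Reflections are involutions, and a translation that commutes with a reflection modulo `K` equals
its own inverse modulo `K`. This reduces the count of homomorphisms to linear algebra over the field
of two elements. -/
theorem sq_eq_one_of_mem_center {K : Subgroup (Dih L)} [K.Normal] {z : Dih L ⧸ K}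
    (h : z ∈ Subgroup.center (Dih L ⧸ K)) : z ^ 2 = 1 := by
  obtain ⟨g, rfl⟩ := QuotientGroup.mk_surjective z
  obtain ⟨v, rfl⟩ | ⟨v, rfl⟩ := eq_rot_or_eq_refl g
  · have := Subgroup.mem_center_iff.1 h (refl 1 : Dih L)
    rw [← QuotientGroup.mk_mul, ← QuotientGroup.mk_mul, eq_comm, QuotientGroup.eq, refl_mul_rot,
      rot_mul_refl, inv_refl, refl_mul_refl] at this
    rw [pow_two, ← QuotientGroup.mk_mul, QuotientGroup.eq_one_iff, ← map_mul]
    simpa using this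
  · rw [pow_two, ← QuotientGroup.mk_mul, refl_mul_refl, mul_inv_cancel, map_one,
      QuotientGroup.mk_one]

end Dih

/-- The order of the center of a quotient of order `a` of the infinite dihedral group. -/
def centerCard (a : ℕ) : ℕ := if a = 4 then 4 else if a = 2 ∨ 4 ∣ a then 2 else 1

theorem center_eq_top_of_card {Q : Type*} [Group Q]
    (h : Nat.card Q = 1 ∨ Nat.card Q = 2 ∨ Nat.card Q = 4) : Subgroup.center Q = ⊤ := by
  have hcomm : ∀ x y : Q, x * y = y * x := by
    obtain h | h | h := h
    · have := (Nat.card_eq_one_iff_unique.1 h).1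
      exact fun x y => Subsingleton.elim _ _
    · have : Fact (Nat.Prime 2) := ⟨Nat.prime_two⟩
      have := isCyclic_of_prime_card h
      exact fun x y => (IsCyclic.commGroup (α := Q)).mul_comm x y
    · have : Fact (Nat.Prime 2) := ⟨Nat.prime_two⟩
      exact (IsPGroup.isMulCommutative_of_card_eq_prime_sq (p := 2) h).is_comm.comm
  exact top_le_iff.1 fun x _ => Subgroup.mem_center_iff.2 fun g => hcomm g x

/-- A central reflection would force `k ∣ 2`, which `3 ≤ k` excludes. A translation by `v` is
central if and only if `k ∣ 2 * v`: modulo `k` this leaves `0`, and also `k / 2` when `k` is even.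
-/
theorem card_center_int {k : ℕ} (hk : 3 ≤ k) :
    Nat.card (Subgroup.center (Dih IntGroup ⧸ (intPow k).range.map Dih.rot)) =
      if 2 ∣ k then 2 else 1 := by
  let K := (intPow k).range.map Dih.rot
  have hcoe : ∀ v : IntGroup, (Dih.rot v : Dih IntGroup ⧸ K) ∈
      Subgroup.center (Dih IntGroup ⧸ K) ↔ (k : ℤ) ∣ 2 * v.toAdd := by
    intro v
    refine Dih.mk_rot_mem_center.trans ?_
    rw [mem_range_intPow]
    simp
  have hrefl : ∀ v : IntGroup, (Dih.refl v : Dih IntGroup ⧸ K) ∉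
      Subgroup.center (Dih IntGroup ⧸ K) := by
    intro v h
    have h1 := Dih.squares_le_of_mk_refl_mem_center h
      (Dih.sq_mem_squares (Multiplicative.ofAdd (1 : ℤ)))
    rw [mem_range_intPow] at h1
    have := Int.le_of_dvd (by norm_num) h1
    simp at this
    omega
  have hone : ∀ v : IntGroup, (Dih.rot v : Dih IntGroup ⧸ K) = 1 ↔ (k : ℤ) ∣ v.toAdd := by
    intro v
    rw [QuotientGroup.eq_one_iff, Dih.rot_mem_map_rot, mem_range_intPow]
  rw [← SetLike.coe_sort_coe, Nat.card_coe_set_eq]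
  split_ifs with h2
  · obtain ⟨j, rfl⟩ := h2
    rw [Set.ncard_eq_two]
    refine ⟨1, (Dih.rot (Multiplicative.ofAdd (j : ℤ)) : Dih IntGroup), ?_, ?_⟩
    · intro h
      have := Int.le_of_dvd (by simp; omega) ((hone _).1 h.symm)
      simp at this
      omega
    · ext z
      simp only [SetLike.mem_coe, Set.mem_insert_iff, Set.mem_singleton_iff]
      constructor
      · intro hz
        obtain ⟨g, rfl⟩ := QuotientGroup.mk_surjective z
        obtain ⟨v, rfl⟩ | ⟨v, rfl⟩ := Dih.eq_rot_or_eq_refl g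
        · obtain ⟨c, hc⟩ := (hcoe v).1 hz
          have hv : v.toAdd = j * c := by push_cast at hc; linarith
          obtain ⟨d, hd | hd⟩ := c.even_or_odd'
          · left
            rw [hone]
            exact ⟨d, by rw [hv, hd]; push_cast; ring⟩
          · right
            rw [eq_comm, QuotientGroup.eq, Dih.inv_rot, ← map_mul, Dih.rot_mem_map_rot,
              mem_range_intPow]
            exact ⟨d, by rw [toAdd_mul, toAdd_inv, hv, hd, toAdd_ofAdd]; push_cast; ring⟩
        · exact absurd hz (hrefl v)
      · rintro (rfl | rfl)
        · exact Subgroup.one_mem _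
        · rw [hcoe]
          exact ⟨1, by simp⟩
  · rw [Set.ncard_eq_one]
    refine ⟨1, ?_⟩
    ext z
    simp only [SetLike.mem_coe, Set.mem_singleton_iff]
    constructor
    · intro hz
      obtain ⟨g, rfl⟩ := QuotientGroup.mk_surjective z
      obtain ⟨v, rfl⟩ | ⟨v, rfl⟩ := Dih.eq_rot_or_eq_refl g
      · rw [hone]
        have hcop : IsCoprime (k : ℤ) 2 := by
          exact_mod_cast Nat.isCoprime_iff_coprime.2
            (Nat.coprime_two_right.2 (by rw [Nat.odd_iff]; omega))
        exact hcop.dvd_of_dvd_mul_left ((hcoe v).1 hz)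
      · exact absurd hz (hrefl v)
    · rintro rfl
      exact Subgroup.one_mem _

/-- Quotients of order `1`, `2` and `4` are commutative. In all other cases `K` contains no
reflection, as this needs index at most two, so `K` is the lattice of index `k = a / 2` with `k ≥
3`. -/
theorem card_center_dih_int {a : ℕ} (ha : a ≠ 0)
    (K : normalSubgroupsOfIndex (Dih IntGroup) a) [K.1.Normal] :
    Nat.card (Subgroup.center (Dih IntGroup ⧸ K.1)) = centerCard a := by
  obtain ⟨K, hK', hK⟩ := K
  dsimp only
  by_cases h : a = 1 ∨ a = 2 ∨ a = 4
  · have hc : Nat.card (Dih IntGroup ⧸ K) = a := hK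
    rw [center_eq_top_of_card (by rwa [hc]), Subgroup.card_top, hc]
    obtain rfl | rfl | rfl := h <;> rfl
  · have hle : K ≤ Dih.rot.range := by
      by_contra hle
      obtain ⟨h1, h2⟩ := card_reflSubgroup_int ha
      rw [intReflCount, if_neg (by omega), if_neg (by omega), Finite.card_eq_zero_iff] at h2
      exact h2.false ⟨⟨K, hK', hK⟩, hle⟩
    obtain ⟨k, hk⟩ := exists_eq_range_intPow (K.comap Dih.rot)
    have hK2 := Subgroup.map_comap_eq_self hle
    rw [hk] at hK2
    subst hK2
    rw [Dih.index_map_rot, index_range_intPow] at hK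
    rw [card_center_int (by omega), centerCard, if_neg (c := a = 4) (by omega)]
    exact if_congr (by omega) rfl rfl

/-! ### Invariant homomorphisms to groups of exponent two. -/

namespace Dih

variable {L : Type*} [CommGroup L]

/-- Here `E` cuts out of `P` exactly what every invariant homomorphism kills, so `d` is the rank of
the largest invariant elementary abelian 2-quotient of `P`. -/
theorem card_invHom_of_iff {Z : Type*} [CommGroup Z] (hZ : ∀ z : Z, z ^ 2 = 1)
    {P E : Subgroup (Dih L)} [E.Normal] (hsq : ∀ p ∈ P, p ^ 2 ∈ E) {d : ℕ}
    (hd : E.relIndex P = 2 ^ d)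
    (hinv : ∀ φ : P →* Z, (∀ (b : Dih L) (p q : P), (q : Dih L) = b * p * b⁻¹ → φ q = φ p) ↔
      ∀ p : P, (p : Dih L) ∈ E → φ p = 1) :
    Nat.card (InvHom P Z) = Nat.card Z ^ d := by
  rw [← card_hom_le_ker (E.subgroupOf P) (fun p => hsq p p.2) hZ hd]
  exact Nat.card_congr (Equiv.subtypeEquivRight hinv)

/-- Conjugation acts on a lattice by inversion or trivially, which a target of exponent two cannot
see. So all homomorphisms are invariant, and `E` is the subgroup of squares of `M`. -/
theorem card_invHom_trans (h4 : (squares L).index = 4)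
    (hL : Function.Injective (powMonoidHom 2 : L →* L)) {Z : Type*} [CommGroup Z]
    (hZ : ∀ z : Z, z ^ 2 = 1) {P : Subgroup (Dih L)} (hP : P ≤ rot.range) (h0 : P.index ≠ 0) :
    Nat.card (InvHom P Z) = Nat.card Z ^ 2 := by
  obtain ⟨M, rfl⟩ : ∃ M : Subgroup L, P = M.map rot :=
    ⟨P.comap rot, (Subgroup.map_comap_eq_self hP).symm⟩
  have hM : M.index ≠ 0 := fun h => h0 (by rw [index_map_rot, h])
  have hsqM : M.map (powMonoidHom 2) ≤ M := by
    rintro _ ⟨v, hv, rfl⟩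
    exact M.pow_mem hv 2
  refine card_invHom_of_iff hZ (E := (M.map (powMonoidHom 2)).map rot) ?_ ?_ ?_
  · rintro _ ⟨v, hv, rfl⟩
    exact ⟨v ^ 2, ⟨v, hv, rfl⟩, map_pow _ _ _⟩
  · rw [Subgroup.relIndex_map_map_of_injective _ _ rot_injective]
    -- With `M²` the image of `M` under squaring, `[M : M²] * [L : M] = [L : M²] = 4 * [L : M]`,
    -- because squaring is injective.
    have h := Subgroup.relIndex_mul_index hsqM
    rw [Subgroup.index_map_of_injective M hL, h4, mul_comm] at h
    exact Nat.eq_of_mul_eq_mul_left (Nat.pos_of_ne_zero hM) h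
  · intro φ
    refine iff_of_true ?_ ?_
    · rintro b ⟨_, v, hv, rfl⟩ q hq
      obtain ⟨w, rfl⟩ | ⟨w, rfl⟩ := eq_rot_or_eq_refl b
      · congr 1
        apply Subtype.ext
        rw [hq, inv_rot, ← map_mul, ← map_mul, mul_comm w, mul_inv_cancel_right]
      · have : q = (⟨rot v, v, hv, rfl⟩ : M.map rot)⁻¹ := by
          apply Subtype.ext
          rw [hq, inv_refl, refl_mul_rot, refl_mul_refl, Subgroup.coe_inv, inv_rot, mul_comm w,
            mul_inv_cancel_right]
        rw [this, map_inv]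
        exact inv_eq_of_mul_eq_one_left (by rw [← pow_two, hZ])
    · rintro p ⟨_, ⟨v, hv, rfl⟩, hp⟩
      have : p = (⟨rot v, v, hv, rfl⟩ : M.map rot) ^ 2 := by
        apply Subtype.ext
        rw [← hp]
        exact map_pow _ _ _
      rw [this, map_pow, hZ]

theorem conj_mul_inv_mem (b p : Dih L) : b * p * b⁻¹ * p⁻¹ ∈ (squares L).map rot := by
  obtain ⟨w, rfl⟩ | ⟨w, rfl⟩ := eq_rot_or_eq_refl b <;>
    obtain ⟨v, rfl⟩ | ⟨v, rfl⟩ := eq_rot_or_eq_refl p <;>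
    simp only [inv_rot, inv_refl, rot_mul_refl, refl_mul_rot, refl_mul_refl, ← map_mul,
      rot_mem_map_rot]
  · exact ⟨1, by simp⟩
  · exact ⟨w, by simp [pow_two, mul_right_comm w v w]⟩
  · exact ⟨v⁻¹, by simp [pow_two, mul_comm, mul_left_comm]⟩
  · exact ⟨w * v⁻¹, by simp [pow_two, mul_comm, mul_left_comm]⟩

theorem sq_mem_map_squares (p : Dih L) : p ^ 2 ∈ (squares L).map rot := by
  obtain ⟨v, rfl⟩ | ⟨v, rfl⟩ := eq_rot_or_eq_refl p
  · rw [← map_pow, rot_mem_map_rot]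
    exact sq_mem_squares v
  · rw [pow_two, refl_mul_refl, mul_inv_cancel, map_one]
    exact Subgroup.one_mem _

/-- The commutator of `rot w` with a reflection in `P` is `rot (w ^ 2)`, so an invariant
homomorphism kills all squares of translations. Conversely all commutators in `Dih L` lie there by
`conj_mul_inv_mem`. The hypothesis `hd` says that these squares have index `2 ^ d` in `P`. -/
theorem card_invHom_refl {Z : Type*} [CommGroup Z] (hZ : ∀ z : Z, z ^ 2 = 1)
    {P : Subgroup (Dih L)} [P.Normal] (hP : ¬ P ≤ rot.range) (h0 : P.index ≠ 0) {d : ℕ}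
    (hd : 2 ^ d * P.index = 2 * (squares L).index) :
    Nat.card (InvHom P Z) = Nat.card Z ^ d := by
  have hE : (squares L).map rot ≤ P := Subgroup.map_le_iff_le_comap.2 (squares_le_comap_rot hP)
  refine card_invHom_of_iff hZ (E := (squares L).map rot) (fun p _ => sq_mem_map_squares p) ?_ ?_
  · have h := Subgroup.relIndex_mul_index hE
    rw [index_map_rot, ← hd] at h
    exact Nat.eq_of_mul_eq_mul_right (Nat.pos_of_ne_zero h0) h
  · intro φ
    constructor
    · rintro h p ⟨_, ⟨w, rfl⟩, hp⟩
      obtain ⟨v, hv⟩ := exists_refl_mem hP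
      have hq : rot w * refl v * (rot w)⁻¹ ∈ P := Subgroup.Normal.conj_mem ‹_› _ hv _
      have h1 : φ ⟨_, hq⟩ = φ ⟨_, hv⟩ := h (rot w) ⟨_, hv⟩ ⟨_, hq⟩ rfl
      have h2 : p = ⟨_, hq⟩ * (⟨_, hv⟩ : P)⁻¹ := by
        apply Subtype.ext
        rw [← hp]
        change _ = rot w * refl v * (rot w)⁻¹ * (refl v)⁻¹
        rw [inv_rot, inv_refl, rot_mul_refl, refl_mul_rot, refl_mul_refl]
        congr 1
        simp [pow_two, mul_right_comm w v w]
      rw [h2, map_mul, map_inv, h1, mul_inv_cancel]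
    · intro h b p q hq
      have := h (q * p⁻¹) (by
        rw [Subgroup.coe_mul, Subgroup.coe_inv, hq]
        exact conj_mul_inv_mem b p)
      rwa [map_mul, map_inv, mul_inv_eq_one] at this

end Dih

theorem plane_sq_injective : Function.Injective (powMonoidHom 2 : PlaneGroup →* PlaneGroup) :=
  fun _ _ h => Prod.ext (intPow_injective two_ne_zero (congrArg Prod.fst h))
    (intPow_injective two_ne_zero (congrArg Prod.snd h))

/-- The rank of the largest invariant elementary abelian 2-quotient of a normal subgroup of index
`b` in the dihedral group of the plane lattice that contains a reflection. -/
def planeReflRank (b : ℕ) : ℕ := if b = 1 then 3 else if b = 2 then 2 else 1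

theorem two_pow_planeReflRank {b : ℕ} (h : planeReflCount b ≠ 0) :
    2 ^ planeReflRank b * b = 2 * 4 := by
  have : b = 1 ∨ b = 2 ∨ b = 4 := by
    by_contra hb
    exact h (by rw [planeReflCount, if_neg (by omega), if_neg (by omega), if_neg (by omega)])
  obtain rfl | rfl | rfl := this <;> rfl

/-! ### Counting the Goursat data for the two dihedral groups. -/

/-- The number of pairs formed by a normal subgroup of index `b` in the dihedral group of the plane
lattice and an invariant homomorphism from it to a group of exponent two and order `q`. -/
def planeHomCount (q b : ℕ) : ℕ :=
  (if 2 ∣ b then σ 1 (b / 2) * q ^ 2 else 0) +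
    planeReflCount b * q ^ planeReflRank b

theorem finite_and_card_sigma_of_split {ι : Type*} {β : ι → Type*} (p : ι → Prop)
    (h1 : Finite (Σ i : {i // p i}, β i)) (h2 : Finite (Σ i : {i // ¬ p i}, β i)) :
    Finite (Σ i, β i) ∧
      Nat.card (Σ i, β i) =
        Nat.card (Σ i : {i // p i}, β i) + Nat.card (Σ i : {i // ¬ p i}, β i) := by
  classical
  let f : (Σ i : {i // p i}, β i) ⊕ (Σ i : {i // ¬ p i}, β i) → Σ i, β i :=
    Sum.elim (fun x => ⟨x.1.1, x.2⟩) (fun x => ⟨x.1.1, x.2⟩)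
  have hf : Function.Bijective f := by
    constructor
    · rintro (⟨⟨i, hi⟩, x⟩ | ⟨⟨i, hi⟩, x⟩) (⟨⟨j, hj⟩, y⟩ | ⟨⟨j, hj⟩, y⟩) h <;>
        obtain ⟨rfl, h⟩ := Sigma.mk.inj_iff.1 h <;> first | contradiction | (cases h; rfl)
    · rintro ⟨i, x⟩
      by_cases hi : p i
      · exact ⟨Sum.inl ⟨⟨i, hi⟩, x⟩, rfl⟩
      · exact ⟨Sum.inr ⟨⟨i, hi⟩, x⟩, rfl⟩
  exact ⟨Finite.of_surjective f hf.2, by rw [← Nat.card_eq_of_bijective f hf, Nat.card_sum]⟩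

theorem card_sigma_invHom_plane {b : ℕ} (hb : b ≠ 0) {Z : Type*} [CommGroup Z] [Finite Z]
    (hZ : ∀ z : Z, z ^ 2 = 1) :
    Finite (Σ P : normalSubgroupsOfIndex (Dih PlaneGroup) b, InvHom P.1 Z) ∧
      Nat.card (Σ P : normalSubgroupsOfIndex (Dih PlaneGroup) b, InvHom P.1 Z) =
        planeHomCount (Nat.card Z) b := by
  have hq : Nat.card Z ≠ 0 := Nat.card_pos.ne'
  obtain ⟨t1, t2⟩ := card_transSubgroup (fun n hn => card_planeSubgroup hn) hb
  obtain ⟨r1, r2⟩ := card_reflSubgroup_plane hb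
  have ht := finite_and_card_sigma_of_const (ι := Dih.TransSubgroup PlaneGroup b)
    (β := fun P => InvHom P.1.1 Z) (pow_ne_zero 2 hq) fun P =>
      Dih.card_invHom_trans index_squares_plane plane_sq_injective hZ P.2 (by rwa [P.1.2.2])
  have hr := finite_and_card_sigma_of_const (ι := Dih.ReflSubgroup PlaneGroup b)
    (β := fun P => InvHom P.1.1 Z)
    (pow_ne_zero (planeReflRank b) hq) fun P => by
      have := P.1.2.1
      refine Dih.card_invHom_refl hZ P.2 (by rwa [P.1.2.2]) ?_
      rw [index_squares_plane, P.1.2.2]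
      -- The subgroup `P` at hand witnesses that the count is nonzero, which forces `b` to be `1`,
      -- `2` or `4`.
      refine two_pow_planeReflRank fun h0 => ?_
      rw [h0, Finite.card_eq_zero_iff] at r2
      exact r2.false P
  have h := finite_and_card_sigma_of_split
    (fun P : normalSubgroupsOfIndex (Dih PlaneGroup) b => P.1 ≤ Dih.rot.range)
    (β := fun P => InvHom P.1 Z) ht.1 hr.1
  refine ⟨h.1, ?_⟩
  rw [h.2, ht.2, hr.2, t2, r2, planeHomCount, ite_mul, zero_mul]

-- For fixed `K` the number of pairs of `P` and homomorphism depends only on the order of the center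
-- of the quotient by `K`, hence only on `a`.
open scoped IsMulCommutative in
theorem card_goursatData_dih {a b : ℕ} (ha : a ≠ 0) (hb : b ≠ 0) :
    Finite (GoursatData (Dih IntGroup) (Dih PlaneGroup) a b) ∧
      Nat.card (GoursatData (Dih IntGroup) (Dih PlaneGroup) a b) =
        intCount a * planeHomCount (centerCard a) b := by
  obtain ⟨k1, k2⟩ := card_normalSubgroupsOfIndex_dih_int ha
  let e : GoursatData (Dih IntGroup) (Dih PlaneGroup) a b ≃
      Σ K : normalSubgroupsOfIndex (Dih IntGroup) a,
        Σ P : normalSubgroupsOfIndex (Dih PlaneGroup) b, GoursatFiber K.1 P.1 :=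
    Equiv.sigmaAssocProd (γ := fun (K : normalSubgroupsOfIndex (Dih IntGroup) a)
      (P : normalSubgroupsOfIndex (Dih PlaneGroup) b) => GoursatFiber K.1 P.1)
  have hfib : ∀ K : normalSubgroupsOfIndex (Dih IntGroup) a,
      Finite (Σ P : normalSubgroupsOfIndex (Dih PlaneGroup) b, GoursatFiber K.1 P.1) ∧
      Nat.card (Σ P : normalSubgroupsOfIndex (Dih PlaneGroup) b, GoursatFiber K.1 P.1) =
        planeHomCount (centerCard a) b := by
    intro K
    have hK := K.2.1
    have hfin : Finite (Dih IntGroup ⧸ K.1) :=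
      Nat.finite_of_card_ne_zero (show K.1.index ≠ 0 by rwa [K.2.2])
    let e' : (Σ P : normalSubgroupsOfIndex (Dih PlaneGroup) b,
        InvHom P.1 (Subgroup.center (Dih IntGroup ⧸ K.1))) ≃
        (Σ P : normalSubgroupsOfIndex (Dih PlaneGroup) b, GoursatFiber K.1 P.1) :=
      Equiv.sigmaCongrRight fun P =>
        have := P.2.1
        invHomEquivGoursatFiber K.1 P.1
    obtain ⟨h1, h2⟩ := card_sigma_invHom_plane hb
      (Z := Subgroup.center (Dih IntGroup ⧸ K.1))
      fun z => Subtype.ext (Dih.sq_eq_one_of_mem_center z.2)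
    refine ⟨Finite.of_equiv _ e', ?_⟩
    rw [← Nat.card_congr e', h2, card_center_dih_int ha]
  have := fun K => (hfib K).1
  refine ⟨Finite.of_equiv _ e.symm, ?_⟩
  have := Fintype.ofFinite (normalSubgroupsOfIndex (Dih IntGroup) a)
  rw [Nat.card_congr e, Nat.card_sigma, Finset.sum_congr rfl fun K _ => (hfib K).2,
    Finset.sum_const, Finset.card_univ, ← Nat.card_eq_fintype_card, k2, smul_eq_mul]

/-! ### The isomorphism of `P2/m` with the product of dihedral groups. -/

namespace Dih

variable {L H : Type*} [CommGroup L] [Group H]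

/-- The homomorphism from the dihedral group given by a homomorphism `f` on the translations and
an involution `s` that inverts its values. -/
def lift (f : L →* H) (s : H) (hs : s * s = 1) (hf : ∀ v, s * f v = f v⁻¹ * s) : Dih L →* H :=
  MonoidHom.mk' (fun g => f g.pos * if g.sign = 1 then 1 else s) (by
    rintro ⟨v, e⟩ ⟨w, d⟩
    have h1 : (-1 : ℤˣ) ≠ 1 := by decide
    have h2 : s * (f w * s) = f w⁻¹ := by rw [← mul_assoc, hf, mul_assoc, hs, mul_one]
    obtain rfl | rfl := Int.units_eq_one_or e <;> obtain rfl | rfl := Int.units_eq_one_or d <;>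
      simp [mk_mul_mk, h1, mul_assoc, hf, h2])

theorem lift_rot (f : L →* H) (s : H) (hs : s * s = 1) (hf : ∀ v, s * f v = f v⁻¹ * s) (v : L) :
    lift f s hs hf (rot v) = f v := by
  simp [lift, rot]

theorem lift_refl (f : L →* H) (s : H) (hs : s * s = 1) (hf : ∀ v, s * f v = f v⁻¹ * s)
    (v : L) : lift f s hs hf (refl v) = f v * s := by
  have h1 : (-1 : ℤˣ) ≠ 1 := by decide
  simp [lift, refl, h1]

/-- Used once for each factor, this reduces the commutation of the two dihedral images in `P2/m` to
that of the generators. -/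
theorem lift_commute {f : L →* H} {s : H} {hs : s * s = 1} {hf : ∀ v, s * f v = f v⁻¹ * s} {h : H}
    (h1 : ∀ v, Commute (f v) h) (h2 : Commute s h) (g : Dih L) :
    Commute (lift f s hs hf g) h := by
  obtain ⟨v, rfl⟩ | ⟨v, rfl⟩ := eq_rot_or_eq_refl g
  · rw [lift_rot]
    exact h1 v
  · rw [lift_refl]
    exact (h1 v).mul_left h2

end Dih

/-- The generator of the infinite cyclic group. -/
abbrev intGen : IntGroup := Multiplicative.ofAdd 1

/-- The images of the generators of `P2/m` in the product of two dihedral groups. -/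
def genImage : Gen → Dih IntGroup × Dih PlaneGroup
  | Gen.x => (1, Dih.rot (intGen, 1))
  | Gen.y => (Dih.rot intGen, 1)
  | Gen.z => (1, Dih.rot (1, intGen))
  | Gen.r => (1, Dih.refl 1)
  | Gen.m => (Dih.refl 1, 1)

theorem genImage_relators : ∀ w ∈ relators, FreeGroup.lift genImage w = 1 := by
  intro w hw
  simp only [relators, Set.mem_insert_iff, Set.mem_singleton_iff] at hw
  obtain rfl | rfl | rfl | rfl | rfl | rfl | rfl | rfl | rfl | rfl | rfl | rfl := hw <;>
    simp only [commWord, conjWord, map_mul, map_inv, map_pow, FreeGroup.lift_apply_of, genImage] <;>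
    rfl

/-- The homomorphism from `P2/m` to the product of two dihedral groups. -/
def toDih : P2m →* Dih IntGroup × Dih PlaneGroup := PresentedGroup.toGroup genImage_relators

/-- The generators of `P2/m`. -/
abbrev gen (a : Gen) : P2m := PresentedGroup.of a

theorem toDih_gen (a : Gen) : toDih (gen a) = genImage a := PresentedGroup.toGroup.of _

theorem mk_eq_one {w : FreeGroup Gen} (h : w ∈ relators) : PresentedGroup.mk relators w = 1 :=
  PresentedGroup.one_of_mem h

theorem commute_of_commWord {a b : Gen}
    (h : commWord (FreeGroup.of a) (FreeGroup.of b) ∈ relators) : Commute (gen a) (gen b) := by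
  have h1 : (gen a)⁻¹ * (gen b)⁻¹ * gen a * gen b = 1 := mk_eq_one h
  rw [mul_assoc, ← mul_inv_rev, inv_mul_eq_one] at h1
  exact h1.symm

theorem mul_eq_of_conjWord {a b : Gen} {w : FreeGroup Gen}
    (h : conjWord (FreeGroup.of a) (FreeGroup.of b) * w⁻¹ ∈ relators) :
    gen a * gen b = gen b * PresentedGroup.mk relators w := by
  have h1 : (gen b)⁻¹ * gen a * gen b * (PresentedGroup.mk relators w)⁻¹ = 1 := mk_eq_one h
  rwa [mul_inv_eq_one, mul_assoc, inv_mul_eq_iff_eq_mul] at h1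

theorem commute_xy : Commute (gen Gen.x) (gen Gen.y) := commute_of_commWord (by simp [relators])
theorem commute_xz : Commute (gen Gen.x) (gen Gen.z) := commute_of_commWord (by simp [relators])
theorem commute_yz : Commute (gen Gen.y) (gen Gen.z) := commute_of_commWord (by simp [relators])
theorem commute_xm : Commute (gen Gen.x) (gen Gen.m) :=
  mul_eq_of_conjWord (w := FreeGroup.of Gen.x) (by simp [relators])
theorem commute_zm : Commute (gen Gen.z) (gen Gen.m) :=
  mul_eq_of_conjWord (w := FreeGroup.of Gen.z) (by simp [relators])
theorem commute_yr : Commute (gen Gen.y) (gen Gen.r) :=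
  mul_eq_of_conjWord (w := FreeGroup.of Gen.y) (by simp [relators])
theorem semiconj_ym : SemiconjBy (gen Gen.m) (gen Gen.y)⁻¹ (gen Gen.y) :=
  (mul_eq_of_conjWord (w := (FreeGroup.of Gen.y)⁻¹) (by simp [relators])).symm
theorem semiconj_xr : SemiconjBy (gen Gen.r) (gen Gen.x)⁻¹ (gen Gen.x) :=
  (mul_eq_of_conjWord (w := (FreeGroup.of Gen.x)⁻¹) (by simp [relators])).symm
theorem semiconj_zr : SemiconjBy (gen Gen.r) (gen Gen.z)⁻¹ (gen Gen.z) :=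
  (mul_eq_of_conjWord (w := (FreeGroup.of Gen.z)⁻¹) (by simp [relators])).symm

theorem gen_r_mul_self : gen Gen.r * gen Gen.r = 1 := by
  rw [← pow_two]
  exact mk_eq_one (w := FreeGroup.of Gen.r ^ 2) (by simp [relators])

theorem gen_m_mul_self : gen Gen.m * gen Gen.m = 1 := by
  rw [← pow_two]
  exact mk_eq_one (w := FreeGroup.of Gen.m ^ 2) (by simp [relators])

theorem commute_mr : Commute (gen Gen.m) (gen Gen.r) := by
  have h : (gen Gen.m * gen Gen.r) ^ 2 = 1 :=
    mk_eq_one (w := (FreeGroup.of Gen.m * FreeGroup.of Gen.r) ^ 2) (by simp [relators])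
  have hm : (gen Gen.m)⁻¹ = gen Gen.m := inv_eq_of_mul_eq_one_left gen_m_mul_self
  have hr : (gen Gen.r)⁻¹ = gen Gen.r := inv_eq_of_mul_eq_one_left gen_r_mul_self
  rw [pow_two, mul_eq_one_iff_eq_inv, mul_inv_rev, hm, hr] at h
  exact h

/-- The homomorphism from the infinite dihedral group to `P2/m`. -/
def ofDihInt : Dih IntGroup →* P2m :=
  Dih.lift (zpowersHom P2m (gen Gen.y)) (gen Gen.m) gen_m_mul_self fun v => by
    have h := semiconj_ym.inv_right.zpow_right v.toAdd
    rw [inv_inv, inv_zpow'] at h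
    exact h

theorem ofDihInt_rot (v : IntGroup) : ofDihInt (Dih.rot v) = gen Gen.y ^ v.toAdd :=
  Dih.lift_rot _ _ _ _ v

theorem ofDihInt_refl (v : IntGroup) :
    ofDihInt (Dih.refl v) = gen Gen.y ^ v.toAdd * gen Gen.m :=
  Dih.lift_refl _ _ _ _ v

/-- The homomorphism from the plane lattice to `P2/m`. -/
def ofPlane : PlaneGroup →* P2m :=
  MonoidHom.noncommCoprod (zpowersHom P2m (gen Gen.x)) (zpowersHom P2m (gen Gen.z)) fun s t => by
    rw [zpowersHom_apply, zpowersHom_apply]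
    exact commute_xz.zpow_zpow _ _

theorem ofPlane_apply (v : PlaneGroup) :
    ofPlane v = gen Gen.x ^ v.1.toAdd * gen Gen.z ^ v.2.toAdd := rfl

/-- The homomorphism from the dihedral group of the plane lattice to `P2/m`. -/
def ofDihPlane : Dih PlaneGroup →* P2m :=
  Dih.lift ofPlane (gen Gen.r) gen_r_mul_self fun v => by
    have hx := semiconj_xr.inv_right.zpow_right v.1.toAdd
    have hz := semiconj_zr.inv_right.zpow_right v.2.toAdd
    rw [inv_inv] at hx hz
    have h := hx.mul_right hz
    rw [inv_zpow', inv_zpow'] at h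
    exact h

theorem ofDihPlane_rot (v : PlaneGroup) : ofDihPlane (Dih.rot v) = ofPlane v :=
  Dih.lift_rot _ _ _ _ v

theorem ofDihPlane_refl (v : PlaneGroup) : ofDihPlane (Dih.refl v) = ofPlane v * gen Gen.r :=
  Dih.lift_refl _ _ _ _ v

theorem commute_ofDihInt_ofDihPlane (g : Dih IntGroup) (h : Dih PlaneGroup) :
    Commute (ofDihInt g) (ofDihPlane h) := by
  have hplane : ∀ {c : P2m}, Commute (gen Gen.x) c → Commute (gen Gen.z) c →
      Commute (gen Gen.r) c → Commute (ofDihPlane h) c := by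
    intro c hx hz hr
    refine Dih.lift_commute (fun v => ?_) hr h
    rw [ofPlane_apply]
    exact (hx.zpow_left _).mul_left (hz.zpow_left _)
  refine Dih.lift_commute (fun v => ?_) ?_ g
  · rw [zpowersHom_apply]
    exact (hplane commute_xy commute_yz.symm commute_yr.symm).symm.zpow_left _
  · exact (hplane commute_xm commute_zm commute_mr.symm).symm

/-- The inverse of `toDih`. -/
def ofDih : Dih IntGroup × Dih PlaneGroup →* P2m :=
  MonoidHom.noncommCoprod ofDihInt ofDihPlane commute_ofDihInt_ofDihPlane

theorem ofDih_toDih (g : P2m) : ofDih (toDih g) = g := by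
  have h : ofDih.comp toDih = MonoidHom.id P2m := by
    refine PresentedGroup.ext fun a => ?_
    change ofDih (toDih (gen a)) = gen a
    rw [toDih_gen]
    cases a <;>
      simp [genImage, ofDih, ofDihInt_rot, ofDihInt_refl, ofDihPlane_rot, ofDihPlane_refl,
        ofPlane_apply]
  exact DFunLike.congr_fun h g

/-- The range contains the powers of the basic translations, then all translations and reflections
of each factor, hence every product `(g, 1) * (1, h)`. -/
theorem toDih_surjective : Function.Surjective toDih := by
  rw [← MonoidHom.range_eq_top, eq_top_iff]
  have hgen : ∀ a, genImage a ∈ toDih.range := fun a => ⟨gen a, toDih_gen a⟩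
  have hy : ∀ v : IntGroup, ((Dih.rot v, 1) : Dih IntGroup × Dih PlaneGroup) ∈ toDih.range := by
    intro v
    convert toDih.range.zpow_mem (hgen Gen.y) v.toAdd using 1
    simp [genImage, ← map_zpow, ← ofAdd_zsmul]
  have hx : ∀ v : IntGroup, ((1, Dih.rot (v, 1)) : Dih IntGroup × Dih PlaneGroup) ∈
      toDih.range := by
    intro v
    convert toDih.range.zpow_mem (hgen Gen.x) v.toAdd using 1
    simp [genImage, ← map_zpow, ← ofAdd_zsmul]
  have hz : ∀ v : IntGroup, ((1, Dih.rot (1, v)) : Dih IntGroup × Dih PlaneGroup) ∈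
      toDih.range := by
    intro v
    convert toDih.range.zpow_mem (hgen Gen.z) v.toAdd using 1
    simp [genImage, ← map_zpow, ← ofAdd_zsmul]
  have h1 : ∀ g : Dih IntGroup, ((g, 1) : Dih IntGroup × Dih PlaneGroup) ∈ toDih.range := by
    intro g
    obtain ⟨v, rfl⟩ | ⟨v, rfl⟩ := Dih.eq_rot_or_eq_refl g
    · exact hy v
    · convert toDih.range.mul_mem (hy v) (hgen Gen.m) using 1
      simp [genImage, Dih.rot_mul_refl]
  have hxz : ∀ v : PlaneGroup, ((1, Dih.rot v) : Dih IntGroup × Dih PlaneGroup) ∈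
      toDih.range := by
    rintro ⟨s, t⟩
    convert toDih.range.mul_mem (hx s) (hz t) using 1
    simp [← map_mul]
  have h2 : ∀ g : Dih PlaneGroup, ((1, g) : Dih IntGroup × Dih PlaneGroup) ∈ toDih.range := by
    intro g
    obtain ⟨v, rfl⟩ | ⟨v, rfl⟩ := Dih.eq_rot_or_eq_refl g
    · exact hxz v
    · convert toDih.range.mul_mem (hxz v) (hgen Gen.r) using 1
      simp [genImage, Dih.rot_mul_refl]
  rintro ⟨g, h⟩ -
  convert toDih.range.mul_mem (h1 g) (h2 h) using 1
  simp

/-- The group `P2/m` is the product of the infinite dihedral group and the dihedral group of the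
plane lattice. -/
noncomputable def dihEquiv : P2m ≃* Dih IntGroup × Dih PlaneGroup :=
  MulEquiv.ofBijective toDih
    ⟨Function.LeftInverse.injective ofDih_toDih, toDih_surjective⟩

/-- An isomorphism of groups maps the normal subgroups of index `n` to each other. -/
def normalSubgroupsOfIndexCongr {G H : Type*} [Group G] [Group H] (e : G ≃* H) (n : ℕ) :
    normalSubgroupsOfIndex G n ≃ normalSubgroupsOfIndex H n :=
  Equiv.subtypeEquiv e.mapSubgroup.toEquiv fun N => by
    constructor
    · rintro ⟨h1, h2⟩
      exact ⟨h1.map e.toMonoidHom e.surjective, (Subgroup.index_map_equiv N e).trans h2⟩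
    · rintro ⟨h1, h2⟩
      refine ⟨?_, (Subgroup.index_map_equiv N e).symm.trans h2⟩
      have := h1.comap e.toMonoidHom
      change ((N.map e.toMonoidHom).comap e.toMonoidHom).Normal at this
      rwa [Subgroup.comap_map_eq_self_of_injective e.injective] at this

theorem finite_and_c_eq {n : ℕ} (hn : n ≠ 0) :
    (normalSubgroupsOfIndex P2m n).Finite ∧
      c n = ∑ p ∈ n.divisorsAntidiagonal,
        intCount p.1 * planeHomCount (centerCard p.1) p.2 := by
  obtain ⟨h1, h2⟩ := finite_and_card_normalSubgroupsOfIndex_prod hn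
    (fun a b => intCount a * planeHomCount (centerCard a) b) fun a b hab =>
      card_goursatData_dih (a := a) (b := b) (by rintro rfl; simp at hab; omega)
        (by rintro rfl; simp at hab; omega)
  have e := normalSubgroupsOfIndexCongr dihEquiv n
  refine ⟨Set.finite_coe_iff.1 (Finite.of_equiv _ e.symm), ?_⟩
  rw [c, ← Nat.card_coe_set_eq, Nat.card_congr e, h2]

/-! ### Evaluation of the divisor sums. -/

theorem sum_divisorsAntidiagonal_ite_eq_right {n d : ℕ} (hn : n ≠ 0) (f : ℕ → ℕ) :
    ∑ p ∈ n.divisorsAntidiagonal, (if p.2 = d then f p.1 else 0) =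
      if d ∣ n then f (n / d) else 0 := by
  rw [Nat.sum_divisorsAntidiagonal' fun a b => if b = d then f a else 0,
    Finset.sum_ite_eq' n.divisors d fun b => f (n / b)]
  simp [hn]

theorem sum_divisorsAntidiagonal_ite_eq_left {n d : ℕ} (hn : n ≠ 0) (f : ℕ → ℕ) :
    ∑ p ∈ n.divisorsAntidiagonal, (if p.1 = d then f p.2 else 0) =
      if d ∣ n then f (n / d) else 0 := by
  rw [Nat.sum_divisorsAntidiagonal fun a b => if a = d then f b else 0,
    Finset.sum_ite_eq' n.divisors d fun b => f (n / b)]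
  simp [hn]

theorem sum_divisorsAntidiagonal_ite_dvd {n d : ℕ} (hn : n ≠ 0) (hd : d ≠ 0) (f : ℕ → ℕ → ℕ) :
    ∑ p ∈ n.divisorsAntidiagonal, (if d ∣ p.2 then f p.1 (p.2 / d) else 0) =
      if d ∣ n then ∑ p ∈ (n / d).divisorsAntidiagonal, f p.1 p.2 else 0 := by
  split_ifs with h
  · obtain ⟨m, rfl⟩ := h
    have hm : m ≠ 0 := right_ne_zero_of_mul hn
    rw [Nat.mul_div_cancel_left m (Nat.pos_of_ne_zero hd), ← Finset.sum_filter]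
    symm
    refine Finset.sum_nbij' (fun p => (p.1, d * p.2)) (fun p => (p.1, p.2 / d)) ?_ ?_ ?_ ?_ ?_
    · rintro ⟨a, b⟩ h
      simp only [Finset.mem_filter, Nat.mem_divisorsAntidiagonal] at h ⊢
      exact ⟨⟨by rw [← h.1]; ring, hn⟩, dvd_mul_right d b⟩
    · rintro ⟨a, b⟩ h
      simp only [Finset.mem_filter, Nat.mem_divisorsAntidiagonal] at h ⊢
      obtain ⟨⟨h1, -⟩, b, rfl⟩ := h
      refine ⟨?_, hm⟩
      rw [Nat.mul_div_cancel_left b (Nat.pos_of_ne_zero hd)]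
      exact Nat.eq_of_mul_eq_mul_left (Nat.pos_of_ne_zero hd) (by rw [← h1]; ring)
    · rintro ⟨a, b⟩ -
      simp [Nat.mul_div_cancel_left b (Nat.pos_of_ne_zero hd)]
    · rintro ⟨a, b⟩ h
      simp only [Finset.mem_filter] at h
      simp [Nat.mul_div_cancel' h.2]
    · rintro ⟨a, b⟩ -
      simp [Nat.mul_div_cancel_left b (Nat.pos_of_ne_zero hd)]
  · refine Finset.sum_eq_zero fun p hp => if_neg fun h' => h ?_
    rw [← (Nat.mem_divisorsAntidiagonal.1 hp).1]
    exact h'.mul_left _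

/-- Cancelling `d` from the first factor leaves the sum of `σ(b)` over all divisors `b` of `n / d`.
-/
theorem sum_divisorsAntidiagonal_ite_dvd_sigma {n d : ℕ} (hn : n ≠ 0) (hd : d ≠ 0) :
    ∑ p ∈ n.divisorsAntidiagonal, (if d ∣ p.1 then σ 1 p.2 else 0) =
      if d ∣ n then sumSigma (n / d) else 0 := by
  rw [← Nat.map_swap_divisorsAntidiagonal, Finset.sum_map]
  refine (sum_divisorsAntidiagonal_ite_dvd hn hd fun a _ => σ 1 a).trans ?_
  split_ifs
  · exact Nat.sum_divisorsAntidiagonal fun a _ => σ 1 a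
  · rfl

/-- The sum of `q ^ j` over the normal subgroups of index `a` in the infinite dihedral group, where
`q` is the order of the center of the quotient. -/
def centerWeight (j a : ℕ) : ℕ := intCount a * centerCard a ^ j

/-- The weight is `1` at `a = 1`, `3 * 2 ^ 2 = 12 = 1 + 11` at `a = 2`, `4 ^ 2 = 16 = 1 + 3 + 12` at
`a = 4`, and otherwise `4 = 1 + 3` for `4 ∣ a`, `1` for other even `a`, `0` for odd `a`. Each
indicator has a simple convolution with `σ`. -/
theorem centerWeight_two {a : ℕ} (ha : a ≠ 0) :
    centerWeight 2 a = (if a = 1 then 1 else 0) + (if 2 ∣ a then 1 else 0) +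
      3 * (if 4 ∣ a then 1 else 0) + 11 * (if a = 2 then 1 else 0) +
      12 * (if a = 4 then 1 else 0) := by
  rw [centerWeight, intCount, centerCard]
  by_cases h1 : a = 1
  · subst h1; decide
  by_cases h2 : a = 2
  · subst h2; decide
  by_cases h4 : a = 4
  · subst h4; decide
  by_cases h5 : 4 ∣ a
  · have h6 : 2 ∣ a := by omega
    simp [h1, h2, h4, h5, h6]
  · by_cases h6 : 2 ∣ a <;> simp [h1, h2, h4, h5, h6]

theorem sum_centerWeight_two_mul_sigma {m : ℕ} (hm : m ≠ 0) :
    ∑ p ∈ m.divisorsAntidiagonal, centerWeight 2 p.1 * σ 1 p.2 =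
      σ 1 m + (if 2 ∣ m then sumSigma (m / 2) else 0) +
        3 * (if 4 ∣ m then sumSigma (m / 4) else 0) +
        11 * (if 2 ∣ m then σ 1 (m / 2) else 0) + 12 * (if 4 ∣ m then σ 1 (m / 4) else 0) := by
  have h : ∀ p ∈ m.divisorsAntidiagonal, centerWeight 2 p.1 * σ 1 p.2 =
      (if p.1 = 1 then σ 1 p.2 else 0) + (if 2 ∣ p.1 then σ 1 p.2 else 0) +
        3 * (if 4 ∣ p.1 then σ 1 p.2 else 0) + 11 * (if p.1 = 2 then σ 1 p.2 else 0) +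
        12 * (if p.1 = 4 then σ 1 p.2 else 0) := by
    intro p hp
    rw [centerWeight_two (Nat.ne_zero_of_mem_divisorsAntidiagonal hp).1]
    simp only [add_mul, mul_assoc, ite_mul, one_mul, zero_mul]
  rw [Finset.sum_congr rfl h]
  simp only [Finset.sum_add_distrib, ← Finset.mul_sum,
    sum_divisorsAntidiagonal_ite_eq_left hm fun b => σ 1 b,
    sum_divisorsAntidiagonal_ite_dvd_sigma hm two_ne_zero,
    sum_divisorsAntidiagonal_ite_dvd_sigma hm four_ne_zero, one_dvd, if_true, Nat.div_one]

/-- The exponent of `centerWeight` is the rank `d`: `2` for lattices, and `3, 2, 1` for the `1, 6,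
4` reflection subgroups of index `1, 2, 4`. -/
theorem intCount_mul_planeHomCount (a b : ℕ) :
    intCount a * planeHomCount (centerCard a) b =
      (if 2 ∣ b then centerWeight 2 a * σ 1 (b / 2) else 0) +
        (if b = 1 then centerWeight 3 a else 0) + 6 * (if b = 2 then centerWeight 2 a else 0) +
        4 * (if b = 4 then centerWeight 1 a else 0) := by
  have h : intCount a * (planeReflCount b * centerCard a ^ planeReflRank b) =
      (if b = 1 then centerWeight 3 a else 0) + 6 * (if b = 2 then centerWeight 2 a else 0) +
        4 * (if b = 4 then centerWeight 1 a else 0) := by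
    rw [planeReflCount, planeReflRank]
    by_cases h1 : b = 1
    · simp [h1, centerWeight]
    by_cases h2 : b = 2
    · simp [h2, centerWeight]; ring
    by_cases h4 : b = 4
    · simp [h4, centerWeight]; ring
    simp [h1, h2, h4]
  rw [planeHomCount, mul_add, h, mul_ite, mul_zero]
  simp only [add_assoc]
  congr 2
  rw [centerWeight]
  ring

theorem c_eq {n : ℕ} (hn : n ≠ 0) :
    c n = (if 2 ∣ n then σ 1 (n / 2) + (if 4 ∣ n then sumSigma (n / 4) else 0) +
        3 * (if 8 ∣ n then sumSigma (n / 8) else 0) +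
        11 * (if 4 ∣ n then σ 1 (n / 4) else 0) + 12 * (if 8 ∣ n then σ 1 (n / 8) else 0)
        else 0) +
      centerWeight 3 n + 6 * (if 2 ∣ n then centerWeight 2 (n / 2) else 0) +
        4 * (if 4 ∣ n then centerWeight 1 (n / 4) else 0) := by
  rw [(finite_and_c_eq hn).2]
  simp only [intCount_mul_planeHomCount, Finset.sum_add_distrib, ← Finset.mul_sum]
  rw [sum_divisorsAntidiagonal_ite_dvd hn two_ne_zero fun a b => centerWeight 2 a * σ 1 b,
    sum_divisorsAntidiagonal_ite_eq_right hn, sum_divisorsAntidiagonal_ite_eq_right hn,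
    sum_divisorsAntidiagonal_ite_eq_right hn, if_pos (one_dvd n), Nat.div_one]
  congr 3
  by_cases h2 : 2 ∣ n
  · rw [if_pos h2, if_pos h2]
    obtain ⟨m, rfl⟩ := h2
    have hm : m ≠ 0 := right_ne_zero_of_mul hn
    have e4 : 2 * m / 4 = m / 2 := by omega
    have e8 : 2 * m / 8 = m / 4 := by omega
    have d4 : 4 ∣ 2 * m ↔ 2 ∣ m := by omega
    have d8 : 8 ∣ 2 * m ↔ 4 ∣ m := by omega
    rw [Nat.mul_div_cancel_left m two_pos, sum_centerWeight_two_mul_sigma hm]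
    simp only [e4, e8, d4, d8]
  · rw [if_neg h2, if_neg h2]

end CrystalGroup

open CrystalGroup in
theorem proposition4p2 :
    (∀ n : ℕ, 1 ≤ n → (CrystalGroup.normalSubgroupsOfIndex CrystalGroup.P2m n).Finite) ∧
    CrystalGroup.c 1 = 1 ∧
    (∀ n : ℕ, Odd n → n ≠ 1 → CrystalGroup.c n = 0) ∧
    CrystalGroup.c 2 = 31 ∧
    CrystalGroup.c 4 = 155 ∧
    CrystalGroup.c 8 = 187 ∧
    CrystalGroup.c 16 = 199 ∧
    (∀ n : ℕ, 1 ≤ n → n % 16 = 0 → n ≠ 16 →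
      CrystalGroup.c n = 40 + σ 1 (n / 2) + 11 * σ 1 (n / 4) + 12 * σ 1 (n / 8)
        + 3 * CrystalGroup.sumSigma (n / 8) + CrystalGroup.sumSigma (n / 4)) ∧
    (∀ n : ℕ, 1 ≤ n → n % 16 = 8 → n ≠ 8 →
      CrystalGroup.c n = 36 + σ 1 (n / 2) + 11 * σ 1 (n / 4) + 12 * σ 1 (n / 8)
        + 3 * CrystalGroup.sumSigma (n / 8) + CrystalGroup.sumSigma (n / 4)) ∧
    (∀ n : ℕ, 1 ≤ n → (n % 16 = 4 ∨ n % 16 = 12) → n ≠ 4 →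
      CrystalGroup.c n = 14 + σ 1 (n / 2) + 11 * σ 1 (n / 4)
        + CrystalGroup.sumSigma (n / 4)) ∧
    (∀ n : ℕ, 1 ≤ n → (n % 16 = 2 ∨ n % 16 = 6 ∨ n % 16 = 10 ∨ n % 16 = 14) → n ≠ 2 →
      CrystalGroup.c n = 1 + σ 1 (n / 2)) := by
  -- Away from `a = 1, 2, 4` the weight depends only on `a` modulo `4`. The values `n = 1, 2, 4, 8,
  -- 16` are those for which one of the integers among `n`, `n / 2`, `n / 4` is `1`, `2` or `4`.
  have one : ∀ {j a : ℕ}, 2 ∣ a → ¬ 4 ∣ a → a ≠ 2 → centerWeight j a = 1 := by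
    intro j a h1 h2 h3
    rw [centerWeight, intCount, centerCard, if_neg (by omega), if_neg (by omega), if_pos h1,
      if_neg (by omega), if_neg (by omega), one_pow, mul_one]
  have two : ∀ {j a : ℕ}, 4 ∣ a → a ≠ 0 → a ≠ 4 → centerWeight j a = 2 ^ j := by
    intro j a h1 h2 h3
    rw [centerWeight, intCount, centerCard, if_neg (by omega), if_neg (by omega),
      if_pos (by omega), if_neg (by omega), if_pos (by omega), one_mul]
  have odd : ∀ {j a : ℕ}, ¬ 2 ∣ a → a ≠ 1 → centerWeight j a = 0 := by
    intro j a h1 h2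
    rw [centerWeight, intCount, if_neg (by omega), if_neg (by omega), if_neg h1, zero_mul]
  refine ⟨fun n hn => (finite_and_c_eq (by omega)).1, ?_, ?_, ?_, ?_, ?_, ?_, ?_, ?_, ?_, ?_⟩
  · rw [c_eq one_ne_zero]
    decide +kernel
  · intro n h h1
    have h2 : ¬ 2 ∣ n := by rw [Nat.odd_iff] at h; omega
    rw [c_eq (by omega), odd h2 h1, if_neg h2, if_neg h2, if_neg (by omega)]
  · rw [c_eq (by norm_num)]
    decide +kernel
  · rw [c_eq (by norm_num)]
    decide +kernel
  · rw [c_eq (by norm_num)]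
    decide +kernel
  · rw [c_eq (by norm_num)]
    decide +kernel
  -- The constant is `2 ^ 3 + 6 * 2 ^ 2 + 4 * 2 = 40`.
  · intro n h1 h h2
    have d2 : 2 ∣ n := by omega
    have d4 : 4 ∣ n := by omega
    have d8 : 8 ∣ n := by omega
    rw [c_eq (by omega), two d4 (by omega) (by omega),
      two (a := n / 2) (by omega) (by omega) (by omega),
      two (a := n / 4) (by omega) (by omega) (by omega)]
    simp only [d2, d4, d8, if_true]
    ring
  -- Now `n / 4` is even but not divisible by `4`, so the last weight drops to `1`: `8 + 24 + 4 =
  -- 36`.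
  · intro n h1 h h2
    have d2 : 2 ∣ n := by omega
    have d4 : 4 ∣ n := by omega
    have d8 : 8 ∣ n := by omega
    rw [c_eq (by omega), two d4 (by omega) (by omega),
      two (a := n / 2) (by omega) (by omega) (by omega),
      one (a := n / 4) (by omega) (by omega) (by omega)]
    simp only [d2, d4, d8, if_true]
    ring
  -- Now `n / 4` is odd and contributes nothing: `8 + 6 = 14`.
  · intro n h1 h h2
    have d2 : 2 ∣ n := by omega
    have d4 : 4 ∣ n := by omega
    have d8 : ¬ 8 ∣ n := by omega
    rw [c_eq (by omega), two d4 (by omega) (by omega),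
      one (a := n / 2) (by omega) (by omega) (by omega),
      odd (a := n / 4) (by omega) (by omega)]
    simp only [d2, d4, d8, if_true, if_false]
    ring
  · intro n h1 h h2
    have d2 : 2 ∣ n := by omega
    have d4 : ¬ 4 ∣ n := by omega
    have d8 : ¬ 8 ∣ n := by omega
    rw [c_eq (by omega), one d2 d4 h2, odd (a := n / 2) (by omega) (by omega)]
    simp only [d2, d4, d8, if_true, if_false]
    ring
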